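/- Setting. Let $\Lambda=\bigcup_{i=1}^{M}(p_i+\mathsf A\mathbb Z^d)\subset\mathbb R^d$ be a homogeneous multilattice, with $\mathsf A\in\mathbb R^{d\times d}$ non-singular and the shifts $p_i$ pairwise distinct modulo $\mathsf A\mathbb Z^d$. Each site $\ell\in\Lambda$ carries an atomic species $z_\ell$, invariant under translations by $\mathsf A\mathbb Z^d$. Write $r_{\ell k}=|\ell-k|$, and assume $r_{\ell k}\ge\mathfrak m>0$ for all distinct $\ell,k\in\Lambda$. Let $N_{\rm b}$ be the number of orbitals per site. The reference Hamiltonian on $\ell^2(\Lambda;\mathbb C^{N_{\rm b}})$ has the entries $$\mathcal H^{ab}_{\ell k}=h^{ab}(\ell-k,z_\ell,z_k)+\delta_{\ell k}\sum_{m\in\Lambda,\,m\ne\ell}t^{ab}(\ell-m,z_\ell,z_m),\qquad \ell,k\in\Lambda,\ 1\le a,b\le N_{\rm b}.$$ Assume (TB): the real functions $h^{ab},t^{ab}$ are $C^1$ in their first argument and, for some $h_0,\gamma_0>0$ and at all arguments $x_{\ell k}=(\ell-k,z_\ell,z_k)$ with $\ell,k\in\Lambda$, $$|h^{ab}(x_{\ell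 k})|+|\nabla h^{ab}(x_{\ell k})|\le h_0e^{-\gamma_0r_{\ell k}},\qquad |t^{ab}(x_{\ell k})|+|\nabla t^{ab}(x_{\ell k})|\le h_0e^{-\gamma_0r_{\ell k}};$$ moreover $h^{ab}(\ell-k,z_\ell,z_k)=h^{ba}(k-\ell,z_k,z_\ell)$, and the on-site sums $\sum_{m\ne\ell}t^{ab}(\ell-m,z_\ell,z_m)$ are symmetric in $a,b$. For $\xi\in\Gamma^*:=2\pi\mathsf A^{-T}[-\tfrac12,\tfrac12)^d$ let $\varepsilon_1(\xi)\le\dots\le\varepsilon_{MN_{\rm b}}(\xi)$ be the eigenvalues of the Hermitian matrix $$[\mathcal H_\xi]^{ab}_{ij}=\sum_{\alpha\in\mathbb Z^d}\mathcal H^{ab}_{p_i+\mathsf A\alpha,\,p_j}\,e^{-i(p_i-p_j+\mathsf A\alpha)\cdot\xi},\qquad 1\le i,j\le M,\ 1\le a,b\le N_{\rm b}.$$ Theorem. There are constants $c_1,C_0>0$ depending only on $d,\mathfrak m,M,N_{\rm b}$ such that, in the above setting, the following holds. The entries $\mathcal H^{ab}_{\ell k}$ define a bounded self-adjoint operator $\mathcal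 H$ on $\ell^2(\Lambda;\mathbb C^{N_{\rm b}})$. Suppose that $1\le N_0<MN_{\rm b}$, $\varepsilon_{\rm F}\notin\sigma(\mathcal H)$ and $\varepsilon_{N_0}(\xi)<\varepsilon_{\rm F}<\varepsilon_{N_0+1}(\xi)$ for all $\xi\in\Gamma^*$. Then the minimum $$\mathsf{gap}_+:=\min_{\xi\in\Gamma^*}\big(\varepsilon_{N_0+1}(\xi)-\varepsilon_{N_0}(\xi)\big)$$ is attained, and the zero-temperature density matrix $\rho=\chi_{(-\infty,\varepsilon_{\rm F})}(\mathcal H)$ satisfies $$|\rho_{\ell k,ab}|\le\frac{C_1}{\mathsf{gap}_+}\,e^{-\eta_+r_{\ell k}}\qquad\text{for all }\ell,k\in\Lambda,\ 1\le a,b\le N_{\rm b},$$ where $$\eta_+=c_1\frac{\gamma_0}{h_0}\min\{h_0,\gamma_0^d\,\mathsf{gap}_+\},\qquad C_1=C_0\,h_0\,(1+\gamma_0^{-d}).$$ -/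

import Mathlib

open scoped Matrix InnerProductSpace

noncomputable section

namespace TightBinding

/-- Euclidean `d`-space. -/
abbrev Space (d : ℕ) : Type := EuclideanSpace ℝ (Fin d)

/-- The Bravais lattice vector `A α`. -/
def latticeVec {d : ℕ} (A : Matrix (Fin d) (Fin d) ℝ) (α : Fin d → ℤ) : Space d :=
  WithLp.toLp 2 (A *ᵥ fun s => (α s : ℝ))

/-- The set `⋃ i, (p_i + A ℤ^d)`. -/
def latticeUnion {d M : ℕ} (A : Matrix (Fin d) (Fin d) ℝ) (p : Fin M → Space d) :
    Set (Space d) :=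
  {x | ∃ (i : Fin M) (α : Fin d → ℤ), x = p i + latticeVec A α}

/-- The spectral projection `χ_{(-∞, μ)}(T)` of a bounded self-adjoint operator `T`, for `μ`
outside its spectrum: then the indicator function is continuous on the spectrum, and the operator
is given by the continuous functional calculus. -/
def spectralProjection {V : Type*} [NormedAddCommGroup V] [InnerProductSpace ℂ V]
    [CompleteSpace V] (T : V →L[ℂ] V) (μ : ℝ) : V →L[ℂ] V :=
  cfc ((Set.Iio μ).indicator (fun _ => (1 : ℝ))) T

/-- A homogeneous multilattice with `M` atoms per unit cell and atomic species in `S`. -/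
structure Multilattice (d M : ℕ) (S : Type*) where
  /-- the matrix `A` of the Bravais lattice `A ℤ^d` -/
  A : Matrix (Fin d) (Fin d) ℝ
  det_ne_zero : A.det ≠ 0
  /-- the shift vectors `p_1, …, p_M` -/
  shift : Fin M → Space d
  /-- the shifts are pairwise distinct modulo `A ℤ^d`, so that a unit cell holds exactly
  `M` atoms -/
  shift_distinct : ∀ i j : Fin M, i ≠ j → ∀ α : Fin d → ℤ, shift i - shift j ≠ latticeVec A α
  /-- the species `z_ℓ` of the atom at the site `ℓ` -/
  species : latticeUnion A shift → S
  /-- the species are invariant under translations in `A ℤ^d` (homogeneity) -/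
  species_periodic : ∀ (ℓ k : latticeUnion A shift) (α : Fin d → ℤ),
    (ℓ : Space d) = (k : Space d) + latticeVec A α → species ℓ = species k

namespace Multilattice

variable {d M : ℕ} {S : Type*} (L : Multilattice d M S)

/-- The Bravais lattice vector `A α`. -/
def vec (α : Fin d → ℤ) : Space d := latticeVec L.A α

/-- The multilattice `Λ = ⋃ i, (p_i + A ℤ^d)`. -/
def sites : Set (Space d) := latticeUnion L.A L.shift

/-- The species `z_ℓ` of the atom at `ℓ ∈ Λ`. -/
def z (ℓ : L.sites) : S := L.species ℓ

/-- The site `p_i + A α` of `Λ`. -/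
def site (i : Fin M) (α : Fin d → ℤ) : L.sites := ⟨L.shift i + L.vec α, i, α, rfl⟩

/-- The minimal distance between distinct sites is at least `m`. -/
def Separated (m : ℝ) : Prop :=
  ∀ ℓ k : L.sites, ℓ ≠ k → m ≤ ‖(ℓ : Space d) - (k : Space d)‖

/-- The cell `Γ* = 2π A^{-T} [-1/2, 1/2)^d` of the reciprocal lattice `2π A^{-T} ℤ^d`. -/
def recipCell : Set (Space d) :=
  {ξ | ∃ x : Fin d → ℝ, (∀ s, -(1 / 2) ≤ x s ∧ x s < 1 / 2) ∧
    ξ = WithLp.toLp 2 ((2 * Real.pi) • ((L.A⁻¹)ᵀ *ᵥ x))}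

variable {Nb : ℕ}

/-- The entries `H^ref_{ℓk}^{ab} = h^{ab}(x_{ℓk}) + δ_{ℓk} ∑_{m ≠ ℓ} t^{ab}(x_{ℓm})` of the
reference Hamiltonian, where `x_{ℓk} = (ℓ - k, z_ℓ, z_k)`. -/
def hamEntry (h t : Fin Nb → Fin Nb → Space d → S → S → ℝ) (ℓ k : L.sites) (a b : Fin Nb) : ℝ :=
  open scoped Classical in
  h a b ((ℓ : Space d) - k) (L.z ℓ) (L.z k) +
    if ℓ = k then ∑' m : {m : L.sites // m ≠ ℓ},
      t a b ((ℓ : Space d) - (m : L.sites)) (L.z ℓ) (L.z m) else 0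

/-- The assumption (TB) on the reference Hamiltonian with constants `h₀`, `γ₀`. -/
structure TB (h t : Fin Nb → Fin Nb → Space d → S → S → ℝ) (h₀ γ₀ : ℝ) : Prop where
  h_contDiff : ∀ a b (ℓ k : L.sites), ContDiff ℝ 1 fun r => h a b r (L.z ℓ) (L.z k)
  t_contDiff : ∀ a b (ℓ k : L.sites), ContDiff ℝ 1 fun r => t a b r (L.z ℓ) (L.z k)
  h_decay : ∀ a b (ℓ k : L.sites),
    |h a b ((ℓ : Space d) - k) (L.z ℓ) (L.z k)|
      + ‖gradient (fun r => h a b r (L.z ℓ) (L.z k)) ((ℓ : Space d) - k)‖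
      ≤ h₀ * Real.exp (-γ₀ * ‖(ℓ : Space d) - k‖)
  t_decay : ∀ a b (ℓ k : L.sites),
    |t a b ((ℓ : Space d) - k) (L.z ℓ) (L.z k)|
      + ‖gradient (fun r => t a b r (L.z ℓ) (L.z k)) ((ℓ : Space d) - k)‖
      ≤ h₀ * Real.exp (-γ₀ * ‖(ℓ : Space d) - k‖)
  h_symm : ∀ a b (ℓ k : L.sites),
    h a b ((ℓ : Space d) - k) (L.z ℓ) (L.z k) = h b a (-((ℓ : Space d) - k)) (L.z k) (L.z ℓ)
  /-- the on-site blocks are symmetric, so that the Hamiltonian is self-adjoint -/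
  onsite_symm : ∀ a b (ℓ : L.sites),
    ∑' m : {m : L.sites // m ≠ ℓ}, t a b ((ℓ : Space d) - (m : L.sites)) (L.z ℓ) (L.z m) =
      ∑' m : {m : L.sites // m ≠ ℓ}, t b a ((ℓ : Space d) - (m : L.sites)) (L.z ℓ) (L.z m)

variable (Nb) in
/-- The Hilbert space `ℓ²(Λ; ℂ^{N_b})`. -/
abbrev Hilb : Type := lp (fun _ : L.sites × Fin Nb => ℂ) 2

/-- The matrix entry `T_{ℓk}^{ab}` of a bounded operator on `ℓ²(Λ; ℂ^{N_b})`. -/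
def entry (T : L.Hilb Nb →L[ℂ] L.Hilb Nb) (ℓ k : L.sites) (a b : Fin Nb) : ℂ :=
  open scoped Classical in
  (T (lp.single 2 (k, b) (1 : ℂ)) : L.sites × Fin Nb → ℂ) (ℓ, a)

/-- The bounded operator `T` has the entries of the reference Hamiltonian. -/
def IsHamiltonian (h t : Fin Nb → Fin Nb → Space d → S → S → ℝ)
    (T : L.Hilb Nb →L[ℂ] L.Hilb Nb) : Prop :=
  ∀ ℓ k a b, L.entry T ℓ k a b = (L.hamEntry h t ℓ k a b : ℂ)

open scoped Classical in
/-- The reference Hamiltonian `H^ref` as a bounded operator on `ℓ²(Λ; ℂ^{N_b})`: the operator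
with the entries `hamEntry` (and `0` if these do not define a bounded operator). -/
def hamiltonian (h t : Fin Nb → Fin Nb → Space d → S → S → ℝ) : L.Hilb Nb →L[ℂ] L.Hilb Nb :=
  if H : ∃ T, L.IsHamiltonian h t T then H.choose else 0

/-- The zero-temperature density matrix `ρ^ref = χ_{(-∞, ε_F)}(H^ref)`. -/
def densityMatrix (h t : Fin Nb → Fin Nb → Space d → S → S → ℝ) (εF : ℝ) :
    L.Hilb Nb →L[ℂ] L.Hilb Nb :=
  spectralProjection (L.hamiltonian h t) εF

/-- The Bloch Hamiltonian `H_ξ`, with the sites `p_1, …, p_M` as representatives of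
`Λ / A ℤ^d`:
`[H_ξ]_{ij}^{ab} = ∑_α [H^ref]_{p_i + Aα, p_j}^{ab} exp(-i (p_i - p_j + Aα) · ξ)`.
By periodicity of `H^ref` these entries do not depend on the choice of representatives. -/
def bloch (h t : Fin Nb → Fin Nb → Space d → S → S → ℝ) (ξ : Space d) :
    Matrix (Fin M × Fin Nb) (Fin M × Fin Nb) ℂ := fun x y =>
  ∑' α : Fin d → ℤ, (L.hamEntry h t (L.site x.1 α) (L.site y.1 0) x.2 y.2 : ℂ) *
    Complex.exp (-Complex.I * ((⟪L.shift x.1 - L.shift y.1 + L.vec α, ξ⟫_ℝ : ℝ) : ℂ))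

end Multilattice

open scoped Classical in
/-- The `n`-th smallest eigenvalue (`1 ≤ n ≤ card ι`, counted with multiplicity) of a Hermitian
matrix; `0` otherwise. Mathlib's `eigenvalues₀` lists the eigenvalues in decreasing order. -/
def nthEigenvalue {ι : Type*} [Fintype ι] [DecidableEq ι] (B : Matrix ι ι ℂ) (n : ℕ) : ℝ :=
  if H : B.IsHermitian ∧ 1 ≤ n ∧ n ≤ Fintype.card ι then
    H.1.eigenvalues₀ ⟨Fintype.card ι - n, by omega⟩ else 0

namespace Multilattice

variable {d M : ℕ} {S : Type*} (L : Multilattice d M S) {Nb : ℕ}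
  (h t : Fin Nb → Fin Nb → Space d → S → S → ℝ)

/-- The energy band `ε_n(ξ)`, `1 ≤ n ≤ M N_b`. -/
def band (n : ℕ) (ξ : Space d) : ℝ := nthEigenvalue (L.bloch h t ξ) n

/-- The set of values of `ε_{N₀+1}(ξ) - ε_{N₀}(ξ)`, `ξ ∈ Γ*`. -/
def gapValues (N₀ : ℕ) : Set ℝ :=
  (fun ξ => L.band h t (N₀ + 1) ξ - L.band h t N₀ ξ) '' L.recipCell

/-- The indirect gap `gap₊ = min_{ξ ∈ Γ*} (ε_{N₀+1}(ξ) - ε_{N₀}(ξ))`. -/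
def gapPlus (N₀ : ℕ) : ℝ := sInf (L.gapValues h t N₀)

/-- `ε_F ∉ σ(H^ref)` and `ε_{N₀}(ξ) < ε_F < ε_{N₀+1}(ξ)` for all `ξ ∈ Γ*`, where `ε_{N₀}` and
`ε_{N₀+1}` are bands of the system. -/
structure FermiLevelInGap (εF : ℝ) (N₀ : ℕ) : Prop where
  one_le : 1 ≤ N₀
  lt_card : N₀ < M * Nb
  notMem_spectrum : εF ∉ spectrum ℝ (L.hamiltonian h t)
  valence_lt : ∀ ξ ∈ L.recipCell, L.band h t N₀ ξ < εF
  lt_conduction : ∀ ξ ∈ L.recipCell, εF < L.band h t (N₀ + 1) ξ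

variable {h t} {h₀ γ₀ : ℝ}

lemma vec_add (α β : Fin d → ℤ) : L.vec (α + β) = L.vec α + L.vec β := by
  have : (fun s => (((α + β) s : ℤ) : ℝ)) = (fun s => (α s : ℝ)) + fun s => (β s : ℝ) := by
    ext s; simp
  simp only [vec, latticeVec, this, Matrix.mulVec_add, WithLp.toLp_add]

lemma vec_neg (α : Fin d → ℤ) : L.vec (-α) = -L.vec α := by
  have h0 : L.vec 0 = 0 := by
    have := L.vec_add 0 0
    simpa using this
  have := L.vec_add (-α) α
  rw [neg_add_cancel, h0] at this
  exact eq_neg_of_add_eq_zero_left this.symm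

/-- The reference Hamiltonian is symmetric. -/
lemma TB.hamEntry_symm (H : L.TB h t h₀ γ₀) (ℓ k : L.sites) (a b : Fin Nb) :
    L.hamEntry h t ℓ k a b = L.hamEntry h t k ℓ b a := by
  by_cases e : ℓ = k
  · subst e
    simp only [hamEntry, if_true]
    rw [H.onsite_symm a b ℓ, H.h_symm a b ℓ ℓ]
    simp
  · simp only [hamEntry, if_neg e, if_neg (Ne.symm e)]
    rw [H.h_symm a b ℓ k, neg_sub]

/-- The translation of `Λ` by the lattice vector `A β`. -/
def translate (β : Fin d → ℤ) : L.sites ≃ L.sites where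
  toFun ℓ := ⟨ℓ + L.vec β, by
    obtain ⟨i, α, hα⟩ := ℓ.2
    exact ⟨i, α + β, by
      rw [hα, add_assoc]; exact congrArg (L.shift i + ·) (L.vec_add α β).symm⟩⟩
  invFun ℓ := ⟨ℓ + L.vec (-β), by
    obtain ⟨i, α, hα⟩ := ℓ.2
    exact ⟨i, α + -β, by
      rw [hα, add_assoc]; exact congrArg (L.shift i + ·) (L.vec_add α (-β)).symm⟩⟩
  left_inv ℓ := by ext1; simp [vec_neg]
  right_inv ℓ := by ext1; simp [vec_neg]

lemma z_translate (β : Fin d → ℤ) (ℓ : L.sites) : L.z (L.translate β ℓ) = L.z ℓ :=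
  L.species_periodic _ _ β rfl

/-- The reference Hamiltonian is periodic. -/
lemma hamEntry_translate (β : Fin d → ℤ) (ℓ k : L.sites) (a b : Fin Nb) :
    L.hamEntry h t (L.translate β ℓ) (L.translate β k) a b = L.hamEntry h t ℓ k a b := by
  have hsub : ∀ x y : L.sites,
      (L.translate β x : Space d) - (L.translate β y : Space d) = (x : Space d) - y := by
    intro x y; simp [translate]
  simp only [hamEntry, hsub, z_translate, (L.translate β).injective.eq_iff]
  congr 2
  let e : {m : L.sites // m ≠ ℓ} ≃ {m : L.sites // m ≠ L.translate β ℓ} :=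
    (L.translate β).subtypeEquiv fun m => (L.translate β).injective.ne_iff.symm
  rw [← e.tsum_eq]
  refine tsum_congr fun m => ?_
  have : ((e m : {m : L.sites // m ≠ L.translate β ℓ}) : L.sites) = L.translate β m := rfl
  rw [this, hsub, z_translate]

/-- The Bloch Hamiltonian is Hermitian, so that `nthEigenvalue` applies to it. -/
lemma TB.bloch_isHermitian (H : L.TB h t h₀ γ₀) (ξ : Space d) : (L.bloch h t ξ).IsHermitian := by
  ext x y
  simp only [Matrix.conjTranspose_apply, bloch]
  rw [Complex.star_def, Complex.conj_tsum, ← (Equiv.neg (Fin d → ℤ)).tsum_eq]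
  refine tsum_congr fun α => ?_
  have h1 : L.hamEntry h t (L.site y.1 (-α)) (L.site x.1 0) y.2 x.2
      = L.hamEntry h t (L.site x.1 α) (L.site y.1 0) x.2 y.2 := by
    rw [H.hamEntry_symm, ← L.hamEntry_translate α]
    congr 1
    · ext1; simp [translate, site, add_assoc, ← vec_add]
    · ext1; simp [translate, site, add_assoc, ← vec_add]
  rw [Equiv.neg_apply, h1, map_mul, Complex.conj_ofReal, ← Complex.exp_conj, vec_neg]
  congr 2
  rw [map_mul, map_neg, Complex.conj_I, Complex.conj_ofReal, neg_neg, neg_mul, ← mul_neg,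
    ← Complex.ofReal_neg, ← inner_neg_left]
  congr 4
  abel

end Multilattice

end TightBinding

end

/-! By periodicity the Hamiltonian is a convolution over `ℤ^d` with matrix coefficients. Its
`symbol` is a Hermitian matrix function on the torus, unitarily equivalent to the Bloch Hamiltonian,
and the entries of the density matrix are the Fourier coefficients of the spectral projections of
the symbol (`entry_spectralProjection_eq_integral`). Such coefficients decay exponentially at a rate
set by how far the projections extend to complex quasi-momenta. The extension needs only a gap at
each separate `θ`: the lower eigenvalues are enclosed by a circle through the midpoint `μ θ` of the
gap, and this circle moves with `θ`. Hence the rate involves `gapPlus`, and not the distance from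
the Fermi level to the spectrum.

The extension is made in a single complex variable. Fix a direction `e` and multiply each
coefficient by `exp (-z * u)`, with `u` its displacement along `e`. Let `F z` be the torus integral
of the Riesz contour integrals of the tilted symbol against a character. For small imaginary `z` the
tilt is a translation of `θ` up to a diagonal unitary, so `F z = exp (-z * U) * ρ`, where `ρ` is the
wanted entry and `U` its displacement. For `‖z‖ < R` the tilt moves the symbol by at most `R * K ≤ g
/ 4`, so the resolvent is at most `4 / g` on the circle; hence `F` is holomorphic and `‖F z‖ ≤ 8 * B
/ g`. The identity theorem carries the formula to `z = -η`, which gives `‖ρ‖ ≤ 8 * B / g * exp (-η *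
U)` (`norm_integral_cfc_symbol_le`). With `e` along `ℓ - k`, `U` is the distance.

The constants come from sums over separated sets. The norm bound `B` is of order `h₀ * (1 + γ₀⁻¹ ^
d)`. The tilt does not change diagonal entries, so `K` is of order `h₀ * γ₀⁻¹ ^ (d + 1)`
(`TB.tiltBound`). The conditions `R ≤ γ₀ / 4` and `R * K ≤ g / 4` yield the two terms of the minimum
in the rate. -/

noncomputable section

namespace TightBinding

/-! ### Resolvents and spectra under bounded perturbations -/

section Perturbation

variable {E : Type*} [CStarAlgebra E]

/-- The resolvent of a self-adjoint element is bounded by the inverse distance to its spectrum. -/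
lemma isUnit_and_norm_resolvent_le {a : E} (ha : IsSelfAdjoint a) {w : ℂ} {δ : ℝ} (hδ : 0 < δ)
    (hw : ∀ r ∈ spectrum ℝ a, δ ≤ ‖w - (r : ℂ)‖) :
    IsUnit (algebraMap ℂ E w - a) ∧ ‖Ring.inverse (algebraMap ℂ E w - a)‖ ≤ δ⁻¹ := by
  have hn : IsStarNormal a := ha.isStarNormal
  have hspec : ∀ v ∈ spectrum ℂ a, δ ≤ ‖w - v‖ := by
    intro v hv
    rw [← ha.spectrumRestricts.algebraMap_image] at hv
    obtain ⟨r, hr, rfl⟩ := hv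
    exact hw r hr
  have hne : ∀ v ∈ spectrum ℂ a, w - v ≠ 0 := fun v hv h0 => by
    have := hspec v hv
    rw [h0, norm_zero] at this
    linarith
  have h1 : cfc (fun v : ℂ => w - v) a = algebraMap ℂ E w - a := by
    rw [cfc_sub _ _ a, cfc_const w a, cfc_id' ℂ a]
  have h2 := cfc_inv (fun v : ℂ => w - v) a hne
  rw [h1] at h2
  refine ⟨?_, ?_⟩
  · rw [← h1]
    exact (isUnit_cfc_iff (fun v : ℂ => w - v) a).2 hne
  · rw [← h2]
    refine norm_cfc_le (inv_nonneg.2 hδ.le) fun v hv => ?_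
    rw [norm_inv]
    exact inv_anti₀ hδ (hspec v hv)

/-- A Neumann series inverts `w - b`, and the resolvent identity gives the bound. Only `a` has to be
self-adjoint: for complex `z` the tilted symbols, which play the role of `b`, are in general not
even normal. -/
lemma isUnit_and_norm_resolvent_le_of_near {a : E} (ha : IsSelfAdjoint a) {w : ℂ} {δ : ℝ}
    (hw : ∀ r ∈ spectrum ℝ a, δ ≤ ‖w - (r : ℂ)‖) {b : E} (hb : ‖b - a‖ < δ) :
    IsUnit (algebraMap ℂ E w - b) ∧
      ‖Ring.inverse (algebraMap ℂ E w - b)‖ ≤ (δ - ‖b - a‖)⁻¹ := by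
  have hδ : 0 < δ := (norm_nonneg _).trans_lt hb
  obtain ⟨hu, hn⟩ := isUnit_and_norm_resolvent_le ha hδ hw
  set A := algebraMap ℂ E w - a with hA
  set B := algebraMap ℂ E w - b with hB
  have hAB : A - B = b - a := by simp [hA, hB]
  have hsmall : ‖Ring.inverse A * (b - a)‖ < 1 := by
    calc _ ≤ ‖Ring.inverse A‖ * ‖b - a‖ := norm_mul_le _ _
      _ ≤ δ⁻¹ * ‖b - a‖ := by gcongr
      _ < δ⁻¹ * δ := by gcongr
      _ = 1 := inv_mul_cancel₀ hδ.ne'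
  have hB' : B = A * (1 - Ring.inverse A * (b - a)) := by
    rw [mul_sub, mul_one, ← mul_assoc, Ring.mul_inverse_cancel _ hu, one_mul, ← hAB]
    abel
  have huB : IsUnit B := by
    rw [hB']
    exact hu.mul (Units.oneSub _ hsmall).isUnit
  refine ⟨huB, ?_⟩
  set X := Ring.inverse B
  have hX : X = Ring.inverse A + Ring.inverse A * (b - a) * X := by
    have : Ring.inverse A * (A - B) * X = X - Ring.inverse A := by
      rw [mul_sub, Ring.inverse_mul_cancel _ hu, sub_mul, one_mul, mul_assoc,
        Ring.mul_inverse_cancel _ huB, mul_one]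
    rw [← hAB, this]
    abel
  have h3 : ‖X‖ ≤ δ⁻¹ + δ⁻¹ * ‖b - a‖ * ‖X‖ := by
    calc ‖X‖ = ‖Ring.inverse A + Ring.inverse A * (b - a) * X‖ := by rw [← hX]
      _ ≤ ‖Ring.inverse A‖ + ‖Ring.inverse A‖ * ‖b - a‖ * ‖X‖ := by
        refine (norm_add_le _ _).trans ?_
        gcongr
        exact (norm_mul_le _ _).trans (by gcongr; exact norm_mul_le _ _)
      _ ≤ _ := by gcongr
  have hpos : 0 < δ - ‖b - a‖ := sub_pos.2 hb
  rw [← one_div, le_div_iff₀ hpos]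
  have h4 := mul_le_mul_of_nonneg_left h3 hδ.le
  have h5 : δ * (δ⁻¹ + δ⁻¹ * ‖b - a‖ * ‖X‖) = 1 + ‖b - a‖ * ‖X‖ := by
    field_simp
  rw [h5] at h4
  linarith

/-- Every spectral value of `b` is within `‖b - a‖` of the spectrum of the self-adjoint
element `a`. -/
lemma exists_mem_spectrum_abs_sub_le {a b : E} (ha : IsSelfAdjoint a) {r : ℝ}
    (hr : r ∈ spectrum ℝ b) : ∃ s ∈ spectrum ℝ a, |r - s| ≤ ‖b - a‖ := by
  by_contra! H
  obtain ⟨δ, hδ, hδ'⟩ : ∃ δ, ‖b - a‖ < δ ∧ ∀ s ∈ spectrum ℝ a, δ ≤ |r - s| := by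
    rcases (spectrum ℝ a).eq_empty_or_nonempty with h0 | h0
    · exact ⟨‖b - a‖ + 1, by simp, by simp [h0]⟩
    · have hc : IsCompact (spectrum ℝ a) := spectrum.isCompact a
      obtain ⟨s, hs, hmin⟩ := hc.exists_isMinOn h0
        (f := fun s => |r - s|) (by fun_prop)
      exact ⟨|r - s|, H s hs, fun s' hs' => hmin hs'⟩
  have := (isUnit_and_norm_resolvent_le_of_near ha (w := (r : ℂ)) (b := b) (δ := δ) (by
    intro s hs
    rw [← Complex.ofReal_sub, Complex.norm_real]
    exact hδ' s hs) hδ).1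
  rw [spectrum.mem_iff] at hr
  exact hr this

end Perturbation

/-! ### Operator norm, functional calculus and Riesz projections of matrices -/

section Matrices

open scoped Matrix.Norms.L2Operator

variable {ι : Type*} [Fintype ι] [DecidableEq ι]

lemma norm_entry_le_l2_opNorm (T : Matrix ι ι ℂ) (i j : ι) : ‖T i j‖ ≤ ‖T‖ := by
  have h1 := T.l2_opNorm_mulVec (EuclideanSpace.single j (1 : ℂ))
  have h2 : ‖EuclideanSpace.single j (1 : ℂ)‖ = ‖(1 : ℂ)‖ := PiLp.norm_single 2 _ j 1
  rw [h2, norm_one, mul_one] at h1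
  refine le_trans ?_ h1
  refine le_trans (le_of_eq ?_) (PiLp.norm_apply_le _ i)
  simp

lemma l2_opNorm_le_sum_norm_entry (T : Matrix ι ι ℂ) : ‖T‖ ≤ ∑ i, ∑ j, ‖T i j‖ := by
  have hs : ∀ (i j : ι) (v : ℂ), ‖Matrix.single i j v‖ ≤ ‖v‖ := by
    intro i j v
    -- The C*-identity reduces a matrix with one nonzero entry to a diagonal one, whose norm is the
    -- largest modulus on the diagonal.
    rw [mul_self_le_mul_self_iff (norm_nonneg _) (norm_nonneg _),
      ← Matrix.l2_opNorm_conjTranspose_mul_self, Matrix.conjTranspose_single,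
      Matrix.single_mul_single_same, ← Matrix.diagonal_single, Matrix.l2_opNorm_diagonal,
      Pi.norm_single]
    simp
  conv_lhs => rw [Matrix.matrix_eq_sum_single T]
  refine (norm_sum_le _ _).trans (Finset.sum_le_sum fun i _ => ?_)
  exact (norm_sum_le _ _).trans (Finset.sum_le_sum fun j _ => hs _ _ _)

lemma cfc_apply_entry {B : Matrix ι ι ℂ} (hB : B.IsHermitian) (f : ℝ → ℝ) (i j : ι) :
    (cfc f B) i j = ∑ l, (hB.eigenvectorUnitary : Matrix ι ι ℂ) i l *
      (f (hB.eigenvalues l) : ℂ) * star ((hB.eigenvectorUnitary : Matrix ι ι ℂ) j l) := by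
  rw [hB.cfc_eq, Matrix.IsHermitian.cfc, Unitary.conjStarAlgAut_apply, Matrix.mul_apply]
  simp [Matrix.mul_diagonal, Matrix.star_apply]

lemma inverse_sub_entry {B : Matrix ι ι ℂ} (hB : B.IsHermitian) (w : ℂ)
    (hw : ∀ l, w - (hB.eigenvalues l : ℂ) ≠ 0) (i j : ι) :
    (Ring.inverse (algebraMap ℂ (Matrix ι ι ℂ) w - B)) i j =
      ∑ l, (hB.eigenvectorUnitary : Matrix ι ι ℂ) i l *
      (w - (hB.eigenvalues l : ℂ))⁻¹ * star ((hB.eigenvectorUnitary : Matrix ι ι ℂ) j l) := by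
  set φ := Unitary.conjStarAlgAut ℂ (Matrix ι ι ℂ) hB.eigenvectorUnitary with hφ
  have h1 : algebraMap ℂ (Matrix ι ι ℂ) w - B
      = φ (Matrix.diagonal fun l => w - (hB.eigenvalues l : ℂ)) := by
    have : (Matrix.diagonal fun l => w - (hB.eigenvalues l : ℂ))
        = algebraMap ℂ (Matrix ι ι ℂ) w - Matrix.diagonal (RCLike.ofReal ∘ hB.eigenvalues) := by
      ext i j
      by_cases h : i = j
      · subst h; simp [Matrix.algebraMap_matrix_apply]
      · simp [Matrix.algebraMap_matrix_apply, h]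
    rw [this, map_sub, AlgHomClass.commutes, ← hB.spectral_theorem]
  set D := (Matrix.diagonal fun l => w - (hB.eigenvalues l : ℂ))
  set D' := (Matrix.diagonal fun l => (w - (hB.eigenvalues l : ℂ))⁻¹) with hD'
  have e1 : D * D' = 1 := by
    rw [Matrix.diagonal_mul_diagonal, ← Matrix.diagonal_one]
    congr 1
    ext l
    exact mul_inv_cancel₀ (hw l)
  have e2 : D' * D = 1 := by
    rw [Matrix.diagonal_mul_diagonal, ← Matrix.diagonal_one]
    congr 1
    ext l
    exact inv_mul_cancel₀ (hw l)
  have h2 : Ring.inverse (algebraMap ℂ (Matrix ι ι ℂ) w - B) = φ D' := by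
    rw [h1]
    exact Ring.inverse_unit (⟨φ D, φ D', by rw [← map_mul, e1, map_one],
      by rw [← map_mul, e2, map_one]⟩ : (Matrix ι ι ℂ)ˣ)
  rw [h2, hφ, Unitary.conjStarAlgAut_apply, Matrix.mul_apply]
  simp [hD', Matrix.mul_diagonal, Matrix.star_apply]

/-- Cauchy's formula inside the circle and Cauchy's theorem outside. Through the spectral theorem
this scalar case yields the Riesz projection of a Hermitian matrix. -/
lemma circleIntegral_sub_inv_real {c R r : ℝ} (hR : 0 < R) (hr : |r - c| ≠ R) :
    (∮ w in C((c : ℂ), R), (w - (r : ℂ))⁻¹) =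
      2 * Real.pi * Complex.I * (({s | |s - c| < R}.indicator (fun _ => (1 : ℝ)) r : ℝ) : ℂ) := by
  have hd : dist (r : ℂ) (c : ℂ) = |r - c| := by
    rw [Complex.dist_eq, ← Complex.ofReal_sub, Complex.norm_real, Real.norm_eq_abs]
  rcases lt_or_gt_of_ne hr with h | h
  · rw [circleIntegral.integral_sub_inv_of_mem_ball (by rw [Metric.mem_ball, hd]; exact h),
      Set.indicator_of_mem (by exact h)]
    simp
  · rw [Set.indicator_of_notMem (by simpa using h.le)]
    simp only [Complex.ofReal_zero, mul_zero]
    have hne : ∀ w ∈ Metric.closedBall (c : ℂ) R, w - (r : ℂ) ≠ 0 := by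
      intro w hw h0
      rw [sub_eq_zero.1 h0, Metric.mem_closedBall, hd] at hw
      linarith
    refine Complex.circleIntegral_eq_zero_of_differentiable_on_off_countable hR.le
      Set.countable_empty ?_ ?_
    · exact ContinuousOn.inv₀ (by fun_prop) hne
    · intro w hw
      exact DifferentiableAt.inv (by fun_prop) (hne w (Metric.ball_subset_closedBall hw.1))

/-- The Riesz projection of a Hermitian matrix, entrywise. -/
lemma circleIntegral_resolvent_entry {B : Matrix ι ι ℂ} (hB : B.IsHermitian) {c R : ℝ}
    (hR : 0 < R) (hs : ∀ r ∈ spectrum ℝ B, |r - c| ≠ R) (i j : ι) :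
    (∮ w in C((c : ℂ), R), (Ring.inverse (algebraMap ℂ (Matrix ι ι ℂ) w - B)) i j) =
      2 * Real.pi * Complex.I *
        (cfc ({s | |s - c| < R}.indicator (fun _ => (1 : ℝ))) B) i j := by
  have hne : ∀ w ∈ Metric.sphere (c : ℂ) R, ∀ l, w - (hB.eigenvalues l : ℂ) ≠ 0 := by
    intro w hw l h0
    rw [sub_eq_zero.1 h0, mem_sphere_iff_norm, ← Complex.ofReal_sub, Complex.norm_real,
      Real.norm_eq_abs] at hw
    exact hs _ (hB.eigenvalues_mem_spectrum_real l) hw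
  rw [circleIntegral.integral_congr hR.le fun w hw => inverse_sub_entry hB w (hne w hw) i j,
    circleIntegral.integral_fun_sum, cfc_apply_entry hB, Finset.mul_sum]
  · refine Finset.sum_congr rfl fun l _ => ?_
    have := circleIntegral_sub_inv_real hR (hs _ (hB.eigenvalues_mem_spectrum_real l))
    simp_rw [mul_right_comm _ _ (star _)]
    rw [circleIntegral.integral_const_mul, this]
    ring
  · intro l _
    refine ContinuousOn.circleIntegrable hR.le ?_
    exact (ContinuousOn.mul continuousOn_const
      (ContinuousOn.inv₀ (by fun_prop) fun w hw => hne w hw l)).mul continuousOn_const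

end Matrices

/-! ### Holomorphic dependence of integrals on a parameter -/

section ParametricIntegral

open MeasureTheory

/-- The integral over a finite measure space of a bounded family of holomorphic functions is
holomorphic. -/
lemma differentiableOn_integral_of_bounded {X : Type*} [MeasurableSpace X] {μ : Measure X}
    [IsFiniteMeasure μ] {f : ℂ → X → ℂ} {R C : ℝ}
    (hm : ∀ z ∈ Metric.ball (0 : ℂ) R, AEStronglyMeasurable (f z) μ)
    (hd : ∀ x, DifferentiableOn ℂ (fun z => f z x) (Metric.ball (0 : ℂ) R))
    (hb : ∀ z ∈ Metric.ball (0 : ℂ) R, ∀ x, ‖f z x‖ ≤ C) :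
    DifferentiableOn ℂ (fun z => ∫ x, f z x ∂μ) (Metric.ball (0 : ℂ) R) := by
  intro z₀ hz₀
  obtain ⟨ε, hε, hsub⟩ := Metric.isOpen_iff.1 (Metric.isOpen_ball (x := (0 : ℂ)) (ε := R)) z₀ hz₀
  have hball : ∀ z ∈ Metric.ball z₀ (ε / 2), Metric.closedBall z (ε / 4) ⊆ Metric.ball 0 R := by
    intro z hz
    refine subset_trans (fun y hy => ?_) hsub
    rw [Metric.mem_ball] at hz ⊢
    rw [Metric.mem_closedBall] at hy
    linarith [dist_triangle y z z₀]
  have hcl : ∀ z ∈ Metric.ball z₀ (ε / 2), z ∈ Metric.ball (0 : ℂ) R := fun z hz =>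
    hball z hz (Metric.mem_closedBall_self (by positivity))
  have hz₀' : z₀ ∈ Metric.ball z₀ (ε / 2) := Metric.mem_ball_self (by positivity)
  have hda : ∀ z ∈ Metric.ball z₀ (ε / 2), ∀ x,
      HasDerivAt (fun z => f z x) (deriv (fun z => f z x) z) z := fun z hz x =>
    ((hd x).differentiableAt (Metric.isOpen_ball.mem_nhds (hcl z hz))).hasDerivAt
  -- Cauchy's estimate on circles of radius `ε / 4` turns the uniform bound on `f` into a constant
  -- dominating function for the derivatives.
  have hbd : ∀ z ∈ Metric.ball z₀ (ε / 2), ∀ x, ‖deriv (fun z => f z x) z‖ ≤ C / (ε / 4) := by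
    intro z hz x
    refine Complex.norm_deriv_le_of_forall_mem_sphere_norm_le (by positivity) ?_ ?_
    · refine DifferentiableOn.diffContOnCl ((hd x).mono ?_)
      exact Metric.closure_ball_subset_closedBall.trans (hball z hz)
    · intro y hy
      exact hb y (hball z hz (Metric.sphere_subset_closedBall hy)) x
  -- The derivative is a pointwise limit of difference quotients along a sequence that tends to `z₀`
  -- and avoids it.
  have hmeas : AEStronglyMeasurable (fun x => deriv (fun z => f z x) z₀) μ := by
    obtain ⟨u, hu⟩ : ∃ u : ℕ → ℂ, (∀ n, u n ∈ Metric.ball z₀ (ε / 2) \ {z₀}) ∧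
        Filter.Tendsto u Filter.atTop (nhdsWithin z₀ {z₀}ᶜ) := by
      have : (nhdsWithin z₀ {z₀}ᶜ).NeBot := inferInstance
      obtain ⟨u, hu⟩ := Filter.exists_seq_tendsto (nhdsWithin z₀ {z₀}ᶜ)
      have hev : ∀ᶠ n in Filter.atTop, u n ∈ Metric.ball z₀ (ε / 2) \ {z₀} :=
        hu.eventually (by
          filter_upwards [self_mem_nhdsWithin,
            mem_nhdsWithin_of_mem_nhds (Metric.ball_mem_nhds z₀ (by positivity : 0 < ε / 2))]
            with y h1 h2 using ⟨h2, h1⟩)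
      obtain ⟨N, hN⟩ := Filter.eventually_atTop.1 hev
      exact ⟨fun n => u (n + N), fun n => hN _ (by omega),
        hu.comp (Filter.tendsto_add_atTop_nat N)⟩
    refine aestronglyMeasurable_of_tendsto_ae (u := Filter.atTop)
      (f := fun n x => slope (fun z => f z x) z₀ (u n)) ?_ ?_
    · intro n
      simp only [slope, vsub_eq_sub]
      exact ((hm _ (hcl _ (hu.1 n).1)).sub (hm _ hz₀)).const_smul (u n - z₀)⁻¹
    · refine Filter.Eventually.of_forall fun x => ?_
      exact (hasDerivAt_iff_tendsto_slope.1 (hda z₀ hz₀' x)).comp hu.2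
  refine (hasDerivAt_integral_of_dominated_loc_of_deriv_le (μ := μ) (F := f)
    (F' := fun z x => deriv (fun z => f z x) z) (bound := fun _ => C / (ε / 4))
    (Metric.ball_mem_nhds z₀ (by positivity : 0 < ε / 2)) ?_ ?_ hmeas ?_ ?_ ?_).2
    |>.differentiableAt.differentiableWithinAt
  · filter_upwards [Metric.isOpen_ball.mem_nhds hz₀] with z hz using hm z hz
  · exact Integrable.of_bound (hm z₀ hz₀) C (Filter.Eventually.of_forall (hb z₀ hz₀))
  · exact Filter.Eventually.of_forall fun x z hz => hbd z hz x
  · exact integrable_const _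
  · exact Filter.Eventually.of_forall fun x z hz => hda z hz x

end ParametricIntegral

/-! ### Exponential sums over separated point sets -/

section LatticeSums

open MeasureTheory

variable {d : ℕ}

lemma integrable_exp_neg_norm : Integrable (fun y : Space d => Real.exp (-‖y‖)) := by
  have h1 : Integrable (fun y : Space d => (1 + ‖y‖) ^ (-((d + 1 : ℕ) : ℝ))) :=
    integrable_one_add_norm (by simp)
  refine Integrable.mono' (h1.const_mul ((d + 1).factorial * Real.exp 1)) (by fun_prop) ?_
  refine Filter.Eventually.of_forall fun y => ?_
  rw [Real.norm_eq_abs, abs_of_pos (Real.exp_pos _), Real.rpow_neg (by positivity),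
    Real.rpow_natCast, ← div_eq_mul_inv, le_div_iff₀ (by positivity)]
  have h2 := Real.pow_div_factorial_le_exp (1 + ‖y‖) (by positivity) (d + 1)
  rw [div_le_iff₀ (by positivity)] at h2
  calc Real.exp (-‖y‖) * (1 + ‖y‖) ^ (d + 1)
      ≤ Real.exp (-‖y‖) * (Real.exp (1 + ‖y‖) * (d + 1).factorial) := by gcongr
    _ = _ := by
      rw [← mul_assoc, ← Real.exp_add, neg_add_eq_sub, add_sub_cancel_right]
      ring

variable (d) in
/-- The constant in the estimate of exponential sums over separated point sets. -/
def expSumConst (m : ℝ) : ℝ :=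
  (volume.real (Metric.ball (0 : Space d) (m / 2)))⁻¹ *
    ((3 / 2) ^ d * ∫ y : Space d, Real.exp (-‖y‖))

lemma expSumConst_nonneg (m : ℝ) : 0 ≤ expSumConst d m := by
  refine mul_nonneg (by positivity) (mul_nonneg (by positivity) ?_)
  exact integral_nonneg fun y => (Real.exp_pos _).le

/-- Packing: the balls of radius `m / 2` about the points are disjoint, so the sum is controlled by
an integral. Leaving out `k = ℓ` gives a pure power `γ⁻¹ ^ d` with no additive constant, which is
the origin of the factor `γ₀ ^ d` in the decay rate. -/
lemma sum_exp_neg_le {m : ℝ} (hm : 0 < m) {Λ : Set (Space d)}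
    (hsep : ∀ x y : Λ, x ≠ y → m ≤ ‖(x : Space d) - y‖) {γ : ℝ} (hγ : 0 < γ) (ℓ : Λ)
    (u : Finset {k : Λ // k ≠ ℓ}) :
    ∑ k ∈ u, Real.exp (-γ * ‖(ℓ : Space d) - (k : Λ)‖) ≤ expSumConst d m * γ⁻¹ ^ d := by
  set V := volume.real (Metric.ball (0 : Space d) (m / 2)) with hV
  have hVpos : 0 < V := by
    rw [hV, Measure.real, ENNReal.toReal_pos_iff]
    exact ⟨Metric.measure_ball_pos _ _ (by positivity), measure_ball_lt_top⟩
  -- On the ball about `k`, `‖y - ℓ‖ ≤ m / 2 + ‖ℓ - k‖ ≤ 3 / 2 * ‖ℓ - k‖` by separation. The factor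
  -- `2 / 3` compensates for this.
  set g : Space d → ℝ := fun y => Real.exp (-‖(2 / 3 * γ) • (y - ℓ)‖) with hg
  have hgi : Integrable g :=
    ((integrable_exp_neg_norm (d := d)).comp_smul (by positivity : (2 / 3 * γ) ≠ 0)).comp_sub_right
      (ℓ : Space d)
  have hI : ∫ y, g y = (2 / 3 * γ)⁻¹ ^ d * ∫ y : Space d, Real.exp (-‖y‖) := by
    rw [hg, integral_sub_right_eq_self (fun y : Space d => Real.exp (-‖(2 / 3 * γ) • y‖)),
      Measure.integral_comp_smul volume (fun y : Space d => Real.exp (-‖y‖)), smul_eq_mul,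
      finrank_euclideanSpace_fin, abs_of_pos (by positivity), inv_pow]
  have hball : ∀ k : {k : Λ // k ≠ ℓ},
      Real.exp (-γ * ‖(ℓ : Space d) - (k : Λ)‖) * V
        ≤ ∫ y in Metric.ball ((k : Λ) : Space d) (m / 2), g y := by
    intro k
    have hVk : volume.real (Metric.ball ((k : Λ) : Space d) (m / 2)) = V := by
      rw [hV, Measure.real, Measure.real, Measure.addHaar_ball_center]
    rw [← hVk]
    refine setIntegral_ge_of_const_le_real measurableSet_ball measure_ball_lt_top.ne ?_
      hgi.integrableOn
    intro y hy
    rw [hg]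
    refine Real.exp_le_exp.2 ?_
    rw [norm_smul, Real.norm_eq_abs, abs_of_pos (by positivity), neg_mul, neg_le_neg_iff]
    have h1 := hsep ℓ k (Ne.symm k.2)
    rw [mem_ball_iff_norm] at hy
    have h2 : ‖y - ℓ‖ ≤ ‖y - ((k : Λ) : Space d)‖ + ‖(ℓ : Space d) - (k : Λ)‖ := by
      rw [norm_sub_rev (ℓ : Space d)]
      exact norm_sub_le_norm_sub_add_norm_sub _ _ _
    nlinarith
  have hdisj : (u : Set {k : Λ // k ≠ ℓ}).Pairwise
      (Function.onFun Disjoint fun k => Metric.ball ((k : Λ) : Space d) (m / 2)) := by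
    intro k _ k' _ hkk
    refine Metric.ball_disjoint_ball ?_
    rw [dist_eq_norm]
    have := hsep k k' fun h => hkk (Subtype.ext h)
    linarith
  have hsum : (∑ k ∈ u, Real.exp (-γ * ‖(ℓ : Space d) - (k : Λ)‖)) * V ≤ ∫ y, g y := by
    rw [Finset.sum_mul]
    refine (Finset.sum_le_sum fun k _ => hball k).trans ?_
    rw [← integral_biUnion_finset u (fun k _ => measurableSet_ball) hdisj
      (fun k _ => hgi.integrableOn)]
    exact setIntegral_le_integral hgi (Filter.Eventually.of_forall fun y => (Real.exp_pos _).le)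
  rw [hI] at hsum
  rw [expSumConst, ← hV, mul_assoc, ← div_eq_inv_mul, le_div_iff₀ hVpos]
  refine hsum.trans (le_of_eq ?_)
  rw [mul_inv, mul_pow, inv_div]
  ring

lemma summable_exp_neg {m : ℝ} (hm : 0 < m) {Λ : Set (Space d)}
    (hsep : ∀ x y : Λ, x ≠ y → m ≤ ‖(x : Space d) - y‖) {γ : ℝ} (hγ : 0 < γ) (ℓ : Λ) :
    Summable fun k : {k : Λ // k ≠ ℓ} => Real.exp (-γ * ‖(ℓ : Space d) - (k : Λ)‖) :=
  summable_of_sum_le (fun _ => (Real.exp_pos _).le) (sum_exp_neg_le hm hsep hγ ℓ)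

lemma tsum_exp_neg_le {m : ℝ} (hm : 0 < m) {Λ : Set (Space d)}
    (hsep : ∀ x y : Λ, x ≠ y → m ≤ ‖(x : Space d) - y‖) {γ : ℝ} (hγ : 0 < γ) (ℓ : Λ) :
    ∑' k : {k : Λ // k ≠ ℓ}, Real.exp (-γ * ‖(ℓ : Space d) - (k : Λ)‖)
      ≤ expSumConst d m * γ⁻¹ ^ d :=
  Real.tsum_le_of_sum_le (fun _ => (Real.exp_pos _).le) (sum_exp_neg_le hm hsep hγ ℓ)

end LatticeSums

/-! ### Bounded operators on `ℓ²` and their matrix entries -/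

section SchurTest

variable {I : Type*}

/-- The Hilbert space `ℓ²(I)`. -/
abbrev SqSumm (I : Type*) : Type _ := lp (fun _ : I => ℂ) 2

lemma schur_sum_sq_le {a : I → I → ℂ} {C : ℝ} (hC : 0 ≤ C)
    (hrow : ∀ i (u : Finset I), ∑ j ∈ u, ‖a i j‖ ≤ C)
    (hcol : ∀ j (u : Finset I), ∑ i ∈ u, ‖a i j‖ ≤ C) (v : SqSumm I) (u : Finset I) :
    ∑ i ∈ u, ‖∑' j, a i j * v j‖ ^ 2 ≤ (C * ‖v‖) ^ 2 := by
  have hv : HasSum (fun j => ‖v j‖ ^ 2) (‖v‖ ^ 2) := by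
    have := lp.hasSum_norm (p := 2) (by simp) v
    simpa using this
  have hs : ∀ i, Summable fun j => ‖a i j‖ := fun i =>
    summable_of_sum_le (fun _ => norm_nonneg _) (hrow i)
  have hav : ∀ i, Summable fun j => ‖a i j‖ * ‖v j‖ := fun i =>
    Summable.of_nonneg_of_le (fun j => by positivity)
      (fun j => mul_le_mul_of_nonneg_left (lp.norm_apply_le_norm (by simp) v j) (norm_nonneg _))
      ((hs i).mul_right ‖v‖)
  have hav2 : ∀ i, Summable fun j => ‖a i j‖ * ‖v j‖ ^ 2 := fun i =>
    Summable.of_nonneg_of_le (fun j => by positivity)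
      (fun j => mul_le_mul_of_nonneg_left (pow_le_pow_left₀ (norm_nonneg _)
        (lp.norm_apply_le_norm (by simp) v j) 2) (norm_nonneg _))
      ((hs i).mul_right (‖v‖ ^ 2))
  -- Cauchy-Schwarz after splitting `‖a‖ * ‖v‖` as `‖a‖^(1/2)` times `‖a‖^(1/2) * ‖v‖`: row sums are
  -- used here, column sums once the order of summation is exchanged.
  have hCS : ∀ i, (∑' j, ‖a i j‖ * ‖v j‖) ^ 2 ≤ C * ∑' j, ‖a i j‖ * ‖v j‖ ^ 2 := by
    intro i
    refine le_of_tendsto ((hav i).hasSum.pow 2) (Filter.Eventually.of_forall fun w => ?_)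
    calc (∑ j ∈ w, ‖a i j‖ * ‖v j‖) ^ 2
        ≤ (∑ j ∈ w, ‖a i j‖) * ∑ j ∈ w, ‖a i j‖ * ‖v j‖ ^ 2 :=
          Finset.sum_sq_le_sum_mul_sum_of_sq_le_mul w (fun _ _ => norm_nonneg _)
            (fun _ _ => by positivity) (fun j _ => le_of_eq (by ring))
      _ ≤ C * ∑' j, ‖a i j‖ * ‖v j‖ ^ 2 := by
          gcongr
          · exact hrow i w
          · exact (hav2 i).sum_le_tsum w (fun j _ => by positivity)
  have h1 : ∀ i, ‖∑' j, a i j * v j‖ ≤ ∑' j, ‖a i j‖ * ‖v j‖ := by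
    intro i
    have := norm_tsum_le_tsum_norm (f := fun j => a i j * v j)
      (by simpa only [norm_mul] using hav i)
    simpa only [norm_mul] using this
  calc ∑ i ∈ u, ‖∑' j, a i j * v j‖ ^ 2
      ≤ ∑ i ∈ u, C * ∑' j, ‖a i j‖ * ‖v j‖ ^ 2 :=
        Finset.sum_le_sum fun i _ => (pow_le_pow_left₀ (norm_nonneg _) (h1 i) 2).trans (hCS i)
    _ = C * ∑' j, ∑ i ∈ u, ‖a i j‖ * ‖v j‖ ^ 2 := by
        rw [← Finset.mul_sum, Summable.tsum_finsetSum fun i _ => hav2 i]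
    _ ≤ C * ∑' j, C * ‖v j‖ ^ 2 := by
        refine mul_le_mul_of_nonneg_left ?_ hC
        refine Summable.tsum_le_tsum (fun j => ?_) (summable_sum fun i _ => hav2 i)
          (hv.summable.mul_left C)
        rw [← Finset.sum_mul]
        gcongr
        exact hcol j u
    _ = (C * ‖v‖) ^ 2 := by
        rw [tsum_mul_left, hv.tsum_eq]
        ring

/-- **Schur's test**: a matrix with uniformly bounded row and column sums defines a bounded
operator on `ℓ²`. -/
theorem exists_clm_of_schur [DecidableEq I] {a : I → I → ℂ} {C : ℝ} (hC : 0 ≤ C)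
    (hrow : ∀ i (u : Finset I), ∑ j ∈ u, ‖a i j‖ ≤ C)
    (hcol : ∀ j (u : Finset I), ∑ i ∈ u, ‖a i j‖ ≤ C) :
    ∃ T : SqSumm I →L[ℂ] SqSumm I, ∀ i j, (T (lp.single 2 j (1 : ℂ)) : I → ℂ) i = a i j := by
  have hsum : ∀ (v : SqSumm I) i, Summable fun j => a i j * v j := by
    intro v i
    refine Summable.of_norm_bounded (g := fun j => ‖a i j‖ * ‖v‖)
      ((summable_of_sum_le (fun _ => norm_nonneg _) (hrow i)).mul_right ‖v‖) fun j => ?_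
    rw [norm_mul]
    exact mul_le_mul_of_nonneg_left (lp.norm_apply_le_norm (by simp) v j) (norm_nonneg _)
  let F : SqSumm I →ₗ[ℂ] SqSumm I :=
    { toFun := fun v => ⟨fun i => ∑' j, a i j * v j, memℓp_gen' (C := (C * ‖v‖) ^ 2) fun u => by
        simpa using schur_sum_sq_le hC hrow hcol v u⟩
      map_add' := fun v w => by
        ext i
        simp only [lp.coeFn_add, Pi.add_apply, mul_add]
        exact (hsum v i).tsum_add (hsum w i)
      map_smul' := fun r v => by
        ext i
        simp only [lp.coeFn_smul, Pi.smul_apply, smul_eq_mul, RingHom.id_apply, mul_left_comm _ r]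
        exact tsum_mul_left }
  refine ⟨F.mkContinuous C fun v => ?_, fun i j => ?_⟩
  · refine lp.norm_le_of_forall_sum_le (by simp) (by positivity) fun u => ?_
    have := schur_sum_sq_le hC hrow hcol v u
    simp only [ENNReal.toReal_ofNat, Real.rpow_ofNat]
    exact this
  · change ∑' k, a i k * (lp.single 2 j (1 : ℂ) : SqSumm I) k = a i j
    rw [tsum_eq_single j fun k hk => ?_]
    · simp
    · simp [lp.single_apply, hk]

lemma hasSum_clm_apply [DecidableEq I] (T : SqSumm I →L[ℂ] SqSumm I) (v : SqSumm I) (i : I) :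
    HasSum (fun j => (T (lp.single 2 j (1 : ℂ)) : I → ℂ) i * v j) ((T v : I → ℂ) i) := by
  have h1 := (lp.hasSum_single (p := 2) (by simp) v).mapL
    ((lp.evalCLM ℂ (fun _ : I => ℂ) 2 i).comp T)
  convert! h1 using 1
  funext j
  symm
  have : lp.single 2 j (v j) = v j • (lp.single 2 j (1 : ℂ) : SqSumm I) := by
    rw [← lp.single_smul, smul_eq_mul, mul_one]
  rw [ContinuousLinearMap.comp_apply, this, map_smul, map_smul, smul_eq_mul, mul_comm]
  rfl

lemma clm_ext_of_entries [DecidableEq I] {T T' : SqSumm I →L[ℂ] SqSumm I}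
    (h : ∀ i j, (T (lp.single 2 j (1 : ℂ)) : I → ℂ) i = (T' (lp.single 2 j (1 : ℂ)) : I → ℂ) i) :
    T = T' := by
  ext v i
  have h1 := hasSum_clm_apply T v i
  simp only [h] at h1
  exact h1.unique (hasSum_clm_apply T' v i)

lemma isSelfAdjoint_of_entries [DecidableEq I] {T : SqSumm I →L[ℂ] SqSumm I}
    (h : ∀ i j, (T (lp.single 2 j (1 : ℂ)) : I → ℂ) i
      = star ((T (lp.single 2 i (1 : ℂ)) : I → ℂ) j)) : IsSelfAdjoint T := by
  rw [ContinuousLinearMap.isSelfAdjoint_iff']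
  refine clm_ext_of_entries fun i j => ?_
  have h1 := lp.inner_single_left (𝕜 := ℂ) (G := fun _ : I => ℂ) i 1
    (ContinuousLinearMap.adjoint T (lp.single 2 j (1 : ℂ)))
  rw [ContinuousLinearMap.adjoint_inner_right, lp.inner_single_right] at h1
  simp only [RCLike.inner_apply, map_one, mul_one, one_mul] at h1
  rw [← h1, h i j]
  rfl

lemma norm_clm_entry_le [DecidableEq I] (T : SqSumm I →L[ℂ] SqSumm I) (i j : I) :
    ‖(T (lp.single 2 j (1 : ℂ)) : I → ℂ) i‖ ≤ ‖T‖ := by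
  refine (lp.norm_apply_le_norm (by simp) _ i).trans ?_
  refine (T.le_opNorm _).trans (le_of_eq ?_)
  rw [lp.norm_single (by simp), norm_one, mul_one]

end SchurTest

/-! ### The symbol of a translation-invariant operator -/

section Symbol

open MeasureTheory UnitAddTorus

open scoped Matrix.Norms.L2Operator

variable {d : ℕ} {ι : Type*}

instance : IsProbabilityMeasure (volume : Measure UnitAddCircle) := ⟨UnitAddCircle.measure_univ⟩

lemma norm_mFourier_apply (n : Fin d → ℤ) (θ : UnitAddTorus (Fin d)) : ‖mFourier n θ‖ = 1 := by
  simp only [mFourier, ContinuousMap.coe_mk, norm_prod, fourier_apply, Circle.norm_coe,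
    Finset.prod_const_one]

lemma mFourier_apply_add (n : Fin d → ℤ) (θ θ' : UnitAddTorus (Fin d)) :
    mFourier n (θ + θ') = mFourier n θ * mFourier n θ' := by
  simp [mFourier, Finset.prod_mul_distrib, smul_add, AddCircle.toCircle_add]

lemma mFourier_apply_coe (n : Fin d → ℤ) (x : Fin d → ℝ) :
    mFourier n (fun s => (x s : UnitAddCircle)) =
      Complex.exp (Complex.I * ((2 * Real.pi * ∑ s, n s * x s : ℝ) : ℂ)) := by
  simp only [mFourier, ContinuousMap.coe_mk, fourier_coe_apply, ← Complex.exp_sum]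
  congr 1
  push_cast
  rw [Finset.mul_sum, Finset.mul_sum]
  refine Finset.sum_congr rfl fun s _ => ?_
  ring

lemma integral_mFourier (n : Fin d → ℤ) :
    ∫ θ : UnitAddTorus (Fin d), mFourier n θ = if n = 0 then 1 else 0 := by
  split_ifs with h
  · subst h
    simp [mFourier_zero]
  · obtain ⟨s, hs⟩ := Function.ne_iff.1 h
    -- A half period in a coordinate where `n` is nonzero: the character equals `-1` at `y`, so by
    -- translation invariance its integral is its own negative.
    set y : UnitAddTorus (Fin d) :=
      fun r => ((Pi.single s (1 / (2 * (n s : ℝ))) : Fin d → ℝ) r : UnitAddCircle) with hy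
    have hns : (n s : ℝ) ≠ 0 := by exact_mod_cast hs
    have hy1 : mFourier n y = -1 := by
      rw [hy, mFourier_apply_coe, Finset.sum_eq_single s]
      · rw [Pi.single_eq_same]
        have : 2 * Real.pi * ((n s : ℝ) * (1 / (2 * (n s : ℝ)))) = Real.pi := by field_simp
        rw [this, mul_comm, Complex.exp_pi_mul_I]
      · intro r _ hr
        rw [Pi.single_eq_of_ne hr, mul_zero]
      · simp
    have h1 := integral_add_right_eq_self (μ := volume) (fun θ => mFourier n θ) y
    simp only [mFourier_apply_add, hy1, mul_neg, mul_one] at h1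
    rw [integral_neg] at h1
    exact self_eq_neg.1 h1.symm

/-- The matrix-valued function on the torus with Fourier coefficients `c`. -/
def symbol (c : (Fin d → ℤ) → ι → ι → ℂ) (θ : UnitAddTorus (Fin d)) : Matrix ι ι ℂ :=
  fun x y => ∑' γ, c γ x y * mFourier (-γ) θ

variable {c : (Fin d → ℤ) → ι → ι → ℂ}

lemma summable_symbol_entry (hc : ∀ x y, Summable fun γ => ‖c γ x y‖)
    (θ : UnitAddTorus (Fin d)) (x y : ι) : Summable fun γ => c γ x y * mFourier (-γ) θ := by
  refine Summable.of_norm_bounded (hc x y) fun γ => ?_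
  rw [norm_mul, norm_mFourier_apply, mul_one]

lemma continuous_symbol (hc : ∀ x y, Summable fun γ => ‖c γ x y‖) : Continuous (symbol c) := by
  refine continuous_pi fun x => continuous_pi fun y => ?_
  refine continuous_tsum (fun γ => by fun_prop) (hc x y) fun γ θ => ?_
  rw [norm_mul, norm_mFourier_apply, mul_one]

lemma symbol_isHermitian (hc : ∀ γ x y, star (c γ y x) = c (-γ) x y)
    (θ : UnitAddTorus (Fin d)) : (symbol c θ).IsHermitian := by
  ext x y
  simp only [Matrix.conjTranspose_apply, symbol]
  rw [Complex.star_def, Complex.conj_tsum, ← (Equiv.neg (Fin d → ℤ)).tsum_eq]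
  refine tsum_congr fun γ => ?_
  have h1 := hc (-γ) x y
  rw [Complex.star_def, neg_neg] at h1
  rw [Equiv.neg_apply, map_mul, h1, mFourier_neg, Complex.conj_conj, mFourier_neg]

lemma symbol_sub {c' : (Fin d → ℤ) → ι → ι → ℂ} (hc : ∀ x y, Summable fun γ => ‖c γ x y‖)
    (hc' : ∀ x y, Summable fun γ => ‖c' γ x y‖) (θ : UnitAddTorus (Fin d)) :
    symbol c θ - symbol c' θ = symbol (fun γ x y => c γ x y - c' γ x y) θ := by
  ext x y
  simp only [Matrix.sub_apply, symbol, sub_mul]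
  exact ((summable_symbol_entry hc θ x y).tsum_sub (summable_symbol_entry hc' θ x y)).symm

lemma integrable_entry_mul_mFourier {G : UnitAddTorus (Fin d) → Matrix ι ι ℂ}
    (hG : Continuous G) (x y : ι) (n : Fin d → ℤ) :
    Integrable fun θ => G θ x y * mFourier n θ := by
  refine Continuous.integrable_of_hasCompactSupport ?_ (HasCompactSupport.of_compactSpace _)
  have : Continuous fun θ => G θ x y := (continuous_apply y).comp ((continuous_apply x).comp hG)
  fun_prop

/-- The convolution theorem for one pair of entries: the symbol is expanded under the integral,
which absolute summability and the boundedness of `G` on the compact torus permit. It drives the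
induction on powers. -/
lemma hasSum_integral_symbol_mul (hc : ∀ x y, Summable fun γ => ‖c γ x y‖)
    {G : UnitAddTorus (Fin d) → Matrix ι ι ℂ} (hG : Continuous G) (x x' y : ι)
    (α β : Fin d → ℤ) :
    HasSum (fun β' => c (α - β') x x' * ∫ θ, G θ x' y * mFourier (β' - β) θ)
      (∫ θ, symbol c θ x x' * G θ x' y * mFourier (α - β) θ) := by
  obtain ⟨B, hB⟩ : ∃ B, ∀ θ, ‖G θ x' y‖ ≤ B := by
    have hcont : Continuous fun θ => ‖G θ x' y‖ :=
      ((continuous_apply y).comp ((continuous_apply x').comp hG)).norm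
    obtain ⟨B, hB⟩ := (isCompact_univ.image hcont).bddAbove
    exact ⟨B, fun θ => hB ⟨θ, trivial, rfl⟩⟩
  have hint := integrable_entry_mul_mFourier hG x' y
  have h1 := hasSum_integral_of_summable_integral_norm (μ := volume)
    (F := fun (γ : Fin d → ℤ) θ => c γ x x' * (G θ x' y * mFourier (α - γ - β) θ))
    (fun γ => (hint _).const_mul _) (by
      refine Summable.of_nonneg_of_le (fun γ => integral_nonneg fun _ => norm_nonneg _)
        (fun γ => ?_) ((hc x x').mul_right B)
      calc ∫ θ, ‖c γ x x' * (G θ x' y * mFourier (α - γ - β) θ)‖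
          ≤ ∫ θ : UnitAddTorus (Fin d), ‖c γ x x'‖ * B := by
            refine integral_mono ((hint _).const_mul _).norm (integrable_const _) fun θ => ?_
            simp only [norm_mul, norm_mFourier_apply, mul_one]
            exact mul_le_mul_of_nonneg_left (hB θ) (norm_nonneg _)
        _ = ‖c γ x x'‖ * B := by simp)
  have h2 := (Equiv.subLeft α).hasSum_iff.2 h1
  have e1 : ∀ θ, ∑' γ, c γ x x' * (G θ x' y * mFourier (α - γ - β) θ)
      = symbol c θ x x' * G θ x' y * mFourier (α - β) θ := by
    intro θ
    rw [symbol, ← tsum_mul_right, ← tsum_mul_right]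
    refine tsum_congr fun γ => ?_
    have : α - γ - β = -γ + (α - β) := by abel
    rw [this, mFourier_add]
    ring
  simp only [e1] at h2
  convert! h2 using 1
  funext β'
  symm
  simp only [Function.comp_apply, Equiv.subLeft_apply, sub_sub_cancel]
  rw [integral_const_mul]

variable [Fintype ι] [DecidableEq ι]

lemma norm_symbol_le (hc : ∀ x y, Summable fun γ => ‖c γ x y‖) (θ : UnitAddTorus (Fin d)) :
    ‖symbol c θ‖ ≤ ∑ x, ∑ y, ∑' γ, ‖c γ x y‖ := by
  refine (l2_opNorm_le_sum_norm_entry _).trans ?_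
  refine Finset.sum_le_sum fun x _ => Finset.sum_le_sum fun y _ => ?_
  refine (norm_tsum_le_tsum_norm ?_).trans (le_of_eq ?_)
  · simpa only [norm_mul, norm_mFourier_apply, mul_one] using hc x y
  · simp only [norm_mul, norm_mFourier_apply, mul_one]

lemma continuous_aeval_symbol (hc : ∀ x y, Summable fun γ => ‖c γ x y‖) (p : Polynomial ℝ) :
    Continuous fun θ => Polynomial.aeval (symbol c θ) p := by
  simp only [Polynomial.aeval_eq_sum_range]
  refine continuous_finsetSum _ fun n _ => Continuous.const_smul ?_ (p.coeff n)
  exact (continuous_symbol hc).pow n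

variable {I : Type*}

/-- The powers of a translation-invariant operator are obtained from the powers of its symbol. -/
theorem entry_pow_eq_integral [DecidableEq I] (hc : ∀ x y, Summable fun γ => ‖c γ x y‖)
    (e : ι × (Fin d → ℤ) ≃ I) {T : SqSumm I →L[ℂ] SqSumm I}
    (hT : ∀ x α y β, (T (lp.single 2 (e (y, β)) (1 : ℂ)) : I → ℂ) (e (x, α)) = c (α - β) x y)
    (n : ℕ) (x y : ι) (α β : Fin d → ℤ) :
    ((T ^ n) (lp.single 2 (e (y, β)) (1 : ℂ)) : I → ℂ) (e (x, α)) =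
      ∫ θ, (symbol c θ ^ n) x y * mFourier (α - β) θ := by
  induction n generalizing x α with
  | zero =>
    simp only [pow_zero, one_apply_eq_self, lp.single_apply]
    rw [integral_const_mul, integral_mFourier]
    by_cases h : (x, α) = (y, β)
    · obtain ⟨rfl, rfl⟩ := Prod.ext_iff.1 h
      simp
    · rw [Pi.single_eq_of_ne fun h' => h (e.injective h')]
      by_cases h1 : x = y
      · have h2 : α - β ≠ 0 := fun h2 => h (by rw [h1, sub_eq_zero.1 h2])
        simp [h2]
      · simp [h1]
  | succ n ih =>
    have hcont : Continuous fun θ => symbol c θ ^ n := (continuous_symbol hc).pow n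
    have h1 := hasSum_clm_apply T ((T ^ n) (lp.single 2 (e (y, β)) (1 : ℂ))) (e (x, α))
    rw [← e.hasSum_iff] at h1
    have h2 := h1.prod_fiberwise fun x' => by
      simp only [Function.comp_apply, hT, ih]
      exact hasSum_integral_symbol_mul hc hcont x x' y α β
    rw [pow_succ', mul_apply_eq_comp]
    rw [h2.unique (hasSum_fintype _)]
    simp only [pow_succ', Matrix.mul_apply, Finset.sum_mul]
    rw [integral_finsetSum]
    intro x' _
    have hi := integrable_entry_mul_mFourier (G := fun θ => Matrix.of fun _ _ : ι =>
      symbol c θ x x' * (symbol c θ ^ n) x' y) (by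
        refine continuous_pi fun _ => continuous_pi fun _ => ?_
        have h3 : Continuous fun θ => symbol c θ x x' :=
          (continuous_apply x').comp ((continuous_apply x).comp (continuous_symbol hc))
        have h4 : Continuous fun θ => (symbol c θ ^ n) x' y :=
          (continuous_apply y).comp ((continuous_apply x').comp hcont)
        exact h3.mul h4) x x (α - β)
    simpa using hi

open scoped Polynomial in
lemma entry_aeval_eq_integral [DecidableEq I] (hc : ∀ x y, Summable fun γ => ‖c γ x y‖)
    (e : ι × (Fin d → ℤ) ≃ I) {T : SqSumm I →L[ℂ] SqSumm I}
    (hT : ∀ x α y β, (T (lp.single 2 (e (y, β)) (1 : ℂ)) : I → ℂ) (e (x, α)) = c (α - β) x y)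
    (p : ℝ[X]) (x y : ι) (α β : Fin d → ℤ) :
    ((Polynomial.aeval T p) (lp.single 2 (e (y, β)) (1 : ℂ)) : I → ℂ) (e (x, α)) =
      ∫ θ, (Polynomial.aeval (symbol c θ) p) x y * mFourier (α - β) θ := by
  induction p using Polynomial.induction_on' with
  | add p q hp hq =>
    simp only [map_add, add_apply, lp.coeFn_add, Pi.add_apply, hp, hq,
      Matrix.add_apply, add_mul]
    rw [integral_add (integrable_entry_mul_mFourier (continuous_aeval_symbol hc p) _ _ _)
      (integrable_entry_mul_mFourier (continuous_aeval_symbol hc q) _ _ _)]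
  | monomial n r =>
    have h1 := entry_pow_eq_integral hc e hT n x y α β
    simp only [Polynomial.aeval_monomial, Algebra.algebraMap_eq_smul_one, smul_mul_assoc, one_mul]
    have h2 : ∀ θ, (r • symbol c θ ^ n) x y * mFourier (α - β) θ
        = (r : ℂ) * ((symbol c θ ^ n) x y * mFourier (α - β) θ) := fun θ => by
      rw [Matrix.smul_apply, Complex.real_smul, mul_assoc]
    simp only [h2]
    rw [integral_const_mul, ← h1]
    simp

end Symbol

/-! ### Polynomial approximation of spectral projections -/

section SpectralApproximation

open scoped Polynomial

/-- The indicator of a half-line is uniformly close to a polynomial on a bounded set at positive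
distance from the jump. -/
lemma exists_polynomial_near_indicator_Iio (B μ : ℝ) {δ ε : ℝ} (hδ : 0 < δ) (hε : 0 < ε) :
    ∃ p : ℝ[X], ∀ r, |r| ≤ B → δ ≤ |r - μ| →
      |p.eval r - (Set.Iio μ).indicator (fun _ => (1 : ℝ)) r| ≤ ε := by
  obtain ⟨p, hp⟩ := exists_polynomial_near_of_continuousOn (-B) B
    -- A linear ramp equal to `1` up to `μ - δ` and to `0` from `μ + δ` on; it agrees with the
    -- indicator wherever the estimate is claimed.
    (fun r => max 0 (min 1 ((μ + δ - r) / (2 * δ)))) (by fun_prop) ε hε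
  refine ⟨p, fun r hr hr' => ?_⟩
  refine (le_of_eq ?_).trans (hp r (abs_le.1 hr)).le
  congr 2
  rcases le_abs.1 hr' with h | h
  · rw [Set.indicator_of_notMem (by simp; linarith), max_eq_left]
    refine (min_le_right _ _).trans (div_nonpos_of_nonpos_of_nonneg (by linarith) (by linarith))
  · rw [Set.indicator_of_mem (by simp; linarith), min_eq_left, max_eq_right zero_le_one]
    rw [le_div_iff₀ (by linarith)]
    linarith

lemma continuousOn_indicator_Iio {μ : ℝ} {s : Set ℝ} (hs : μ ∉ s) :
    ContinuousOn ((Set.Iio μ).indicator (fun _ => (1 : ℝ))) s := by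
  intro r hr
  have hne : r ≠ μ := fun h => hs (h ▸ hr)
  refine ContinuousAt.continuousWithinAt ?_
  refine (continuousOn_const.continuousAt_indicator ?_)
  rw [frontier_Iio]
  exact hne

/-- The error depends only on the norm bound and the gap. The statement is kept abstract so that it
serves both the operator on `ℓ²` and every value of its symbol. -/
lemma norm_aeval_sub_cfc_le {E : Type*} [NormedRing E] [StarRing E] [NormedAlgebra ℝ E]
    [IsometricContinuousFunctionalCalculus ℝ E IsSelfAdjoint] [NormOneClass E] [CompleteSpace E]
    {a : E} (ha : IsSelfAdjoint a) {B μ δ ε : ℝ} (hδ : 0 < δ) (hε : 0 ≤ ε) (hB : ‖a‖ ≤ B)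
    (hgap : ∀ r ∈ spectrum ℝ a, δ ≤ |r - μ|) {p : ℝ[X]}
    (hp : ∀ r, |r| ≤ B → δ ≤ |r - μ| →
      |p.eval r - (Set.Iio μ).indicator (fun _ => (1 : ℝ)) r| ≤ ε) :
    ‖Polynomial.aeval a p - cfc ((Set.Iio μ).indicator (fun _ => (1 : ℝ))) a‖ ≤ ε := by
  have hμ : μ ∉ spectrum ℝ a := fun h => by
    have := hgap μ h
    rw [sub_self, abs_zero] at this
    linarith
  rw [← cfc_polynomial p a, ← cfc_sub _ _ a (by fun_prop) (continuousOn_indicator_Iio hμ)]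
  refine norm_cfc_le hε fun r hr => ?_
  refine hp r ?_ (hgap r hr)
  have := spectrum.norm_le_norm_of_mem hr
  rw [Real.norm_eq_abs] at this
  exact this.trans hB

end SpectralApproximation

/-! ### The density matrix as Fourier coefficients -/

section DensityMatrix

open MeasureTheory UnitAddTorus

open scoped Matrix.Norms.L2Operator

lemma continuous_entry {X ι : Type*} [TopologicalSpace X] {G : X → Matrix ι ι ℂ}
    (hG : Continuous G) (x y : ι) : Continuous fun θ => G θ x y :=
  (continuous_apply y).comp ((continuous_apply x).comp hG)

variable {d : ℕ} {ι I : Type*} [Fintype ι] [DecidableEq ι] [Nonempty ι] [Nonempty I]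
  {c : (Fin d → ℤ) → ι → ι → ℂ}

/-- The norm bound and the gap `δ` are uniform in `θ`, so one polynomial approximates all the
projections at once, and a uniform limit of continuous functions is continuous. -/
lemma continuous_cfc_symbol (hc : ∀ x y, Summable fun γ => ‖c γ x y‖)
    (hherm : ∀ θ, (symbol c θ).IsHermitian) {μ δ : ℝ} (hδ : 0 < δ)
    (hgap : ∀ θ, ∀ r ∈ spectrum ℝ (symbol c θ), δ ≤ |r - μ|) :
    Continuous fun θ => cfc ((Set.Iio μ).indicator (fun _ => (1 : ℝ))) (symbol c θ) := by
  refine continuous_of_uniform_approx_of_continuous fun u hu => ?_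
  obtain ⟨ε, hε, hεu⟩ := Metric.mem_uniformity_dist.1 hu
  obtain ⟨p, hp⟩ := exists_polynomial_near_indicator_Iio
    (∑ x, ∑ y, ∑' γ, ‖c γ x y‖) μ hδ (half_pos hε)
  refine ⟨fun θ => Polynomial.aeval (symbol c θ) p, continuous_aeval_symbol hc p,
    fun θ => hεu ?_⟩
  rw [dist_comm, dist_eq_norm]
  refine (norm_aeval_sub_cfc_le (hherm θ) hδ (half_pos hε).le (norm_symbol_le hc θ) (hgap θ)
    hp).trans_lt (half_lt_self hε)

/-- The entries of the spectral projection of a translation-invariant operator are the Fourier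
coefficients of the spectral projections of its symbol. -/
theorem entry_spectralProjection_eq_integral [DecidableEq I] (hc : ∀ x y, Summable fun γ => ‖c γ x y‖)
    (hherm : ∀ θ, (symbol c θ).IsHermitian)
    (e : ι × (Fin d → ℤ) ≃ I) {T : SqSumm I →L[ℂ] SqSumm I} (hsa : IsSelfAdjoint T)
    (hT : ∀ x α y β, (T (lp.single 2 (e (y, β)) (1 : ℂ)) : I → ℂ) (e (x, α)) = c (α - β) x y)
    {μ δ : ℝ} (hδ : 0 < δ) (hgap : ∀ θ, ∀ r ∈ spectrum ℝ (symbol c θ), δ ≤ |r - μ|)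
    (hμ : μ ∉ spectrum ℝ T) (x y : ι) (α β : Fin d → ℤ) :
    (spectralProjection T μ (lp.single 2 (e (y, β)) (1 : ℂ)) : I → ℂ) (e (x, α)) =
      ∫ θ, (cfc ((Set.Iio μ).indicator (fun _ => (1 : ℝ))) (symbol c θ)) x y *
        mFourier (α - β) θ := by
  obtain ⟨δ', hδ', hgap'⟩ : ∃ δ' > 0, ∀ r ∈ spectrum ℝ T, δ' ≤ |r - μ| := by
    have hcl : IsClosed (spectrum ℝ T) := spectrum.isClosed T
    obtain ⟨δ', hδ', hsub⟩ := Metric.isOpen_iff.1 hcl.isOpen_compl μ hμ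
    refine ⟨δ', hδ', fun r hr => ?_⟩
    by_contra! h
    exact hsub (Metric.mem_ball.2 (by rwa [Real.dist_eq])) hr
  have : Nontrivial (SqSumm I) := by
    obtain ⟨i⟩ := (inferInstance : Nonempty I)
    refine ⟨lp.single 2 i 1, 0, fun h => ?_⟩
    have := congrArg norm h
    rw [lp.norm_single (by simp)] at this
    simp at this
  set P := fun θ => cfc ((Set.Iio μ).indicator (fun _ => (1 : ℝ))) (symbol c θ) with hP
  have hPc : Continuous P := continuous_cfc_symbol hc hherm hδ hgap
  refine eq_of_forall_dist_le fun ε hε => ?_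
  set S := ∑ x, ∑ y, ∑' γ, ‖c γ x y‖
  -- A single polynomial serves both the operator and its symbol. The spectral gaps of the two are
  -- separate data, so no relation between their spectra is needed.
  obtain ⟨p, hp⟩ := exists_polynomial_near_indicator_Iio (max S ‖T‖) μ
    (lt_min hδ hδ') (half_pos hε)
  have h1 : ‖Polynomial.aeval T p - spectralProjection T μ‖ ≤ ε / 2 :=
    norm_aeval_sub_cfc_le hsa (lt_min hδ hδ') (half_pos hε).le (le_max_right _ _)
      (fun r hr => (min_le_right _ _).trans (hgap' r hr)) hp
  have h2 : ∀ θ, ‖Polynomial.aeval (symbol c θ) p - P θ‖ ≤ ε / 2 := fun θ =>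
    norm_aeval_sub_cfc_le (hherm θ) (lt_min hδ hδ') (half_pos hε).le
      ((norm_symbol_le hc θ).trans (le_max_left _ _))
      (fun r hr => (min_le_left _ _).trans (hgap θ r hr)) hp
  have h3 := entry_aeval_eq_integral hc e hT p x y α β
  have h4 := (norm_clm_entry_le (Polynomial.aeval T p - spectralProjection T μ)
    (e (x, α)) (e (y, β))).trans h1
  rw [sub_apply, lp.coeFn_sub, Pi.sub_apply, h3] at h4
  have h5 : ‖(∫ θ, (Polynomial.aeval (symbol c θ) p) x y * mFourier (α - β) θ) -
      ∫ θ, P θ x y * mFourier (α - β) θ‖ ≤ ε / 2 := by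
    rw [← integral_sub (integrable_entry_mul_mFourier (continuous_aeval_symbol hc p) _ _ _)
      (integrable_entry_mul_mFourier hPc _ _ _)]
    refine (norm_integral_le_of_norm_le_const (C := ε / 2)
      (Filter.Eventually.of_forall fun θ => ?_)).trans (by simp)
    rw [← sub_mul, norm_mul, norm_mFourier_apply, mul_one, ← Matrix.sub_apply]
    exact (norm_entry_le_l2_opNorm _ _ _).trans (h2 θ)
  rw [← dist_eq_norm] at h4 h5
  rw [dist_comm] at h4
  exact (dist_triangle _ _ _).trans ((add_le_add h4 h5).trans_eq (add_halves ε))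

end DensityMatrix

/-! ### Exponential tilts and the Combes-Thomas estimate -/

section Tilt

open MeasureTheory UnitAddTorus

open scoped Matrix.Norms.L2Operator

variable {d : ℕ} {ι : Type*}

/-- The Fourier coefficients `c` tilted by the exponential weight `e^{-z u}`, where `u` is the
displacement `q_x - q_y + v · γ`. -/
def tilt (c : (Fin d → ℤ) → ι → ι → ℂ) (q : ι → ℝ) (v : Fin d → ℝ) (z : ℂ) :
    (Fin d → ℤ) → ι → ι → ℂ :=
  fun γ x y => c γ x y * Complex.exp (-z * ((q x - q y + ∑ s, v s * γ s : ℝ) : ℂ))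

variable {c : (Fin d → ℤ) → ι → ι → ℂ} {q : ι → ℝ} {v : Fin d → ℝ}

/-- Tilting by an imaginary weight translates the symbol, up to a diagonal unitary matrix. -/
lemma symbol_tilt_I (c : (Fin d → ℤ) → ι → ι → ℂ) (q : ι → ℝ) (v : Fin d → ℝ) (τ : ℝ)
    (θ : UnitAddTorus (Fin d)) (x y : ι) :
    symbol (tilt c q v (τ * Complex.I)) θ x y =
      Complex.exp (-(τ * q x : ℝ) * Complex.I) *
        symbol c (θ + fun s => ((τ * v s / (2 * Real.pi) : ℝ) : UnitAddCircle)) x y *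
          Complex.exp ((τ * q y : ℝ) * Complex.I) := by
  rw [symbol, symbol, ← tsum_mul_left, ← tsum_mul_right]
  refine tsum_congr fun γ => ?_
  rw [mFourier_apply_add, mFourier_apply_coe, tilt]
  have h1 : Complex.exp (-(τ * Complex.I) * ((q x - q y + ∑ s, v s * γ s : ℝ) : ℂ))
      = Complex.exp (-(τ * q x : ℝ) * Complex.I) * Complex.exp ((τ * q y : ℝ) * Complex.I) *
        Complex.exp (Complex.I *
          ((2 * Real.pi * ∑ s, ((-γ) s : ℤ) * (τ * v s / (2 * Real.pi)) : ℝ) : ℂ)) := by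
    rw [← Complex.exp_add, ← Complex.exp_add]
    congr 1
    have : 2 * Real.pi * ∑ s, (((-γ) s : ℤ) : ℝ) * (τ * v s / (2 * Real.pi))
        = -(τ * ∑ s, v s * γ s) := by
      rw [Finset.mul_sum, Finset.mul_sum, ← Finset.sum_neg_distrib]
      refine Finset.sum_congr rfl fun s _ => ?_
      have := Real.pi_ne_zero
      push_cast [Pi.neg_apply]
      field_simp
    rw [this]
    push_cast
    ring
  rw [h1]
  ring

variable [Fintype ι] [DecidableEq ι]

variable (q) in
/-- The diagonal unitary matrix with entries `e^{-iτ q_x}`. -/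
def phase (τ : ℝ) : unitary (Matrix ι ι ℂ) :=
  ⟨Matrix.diagonal fun x => Complex.exp (-(τ * q x : ℝ) * Complex.I), by
    have h : ∀ x, Complex.exp (-(τ * q x : ℝ) * Complex.I) *
        star (Complex.exp (-(τ * q x : ℝ) * Complex.I)) = 1 := by
      intro x
      rw [Complex.star_def, ← Complex.exp_conj, ← Complex.exp_add]
      simp
    rw [Unitary.mem_iff, Matrix.star_eq_conjTranspose, Matrix.diagonal_conjTranspose,
      Matrix.diagonal_mul_diagonal, Matrix.diagonal_mul_diagonal, ← Matrix.diagonal_one]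
    constructor
    · congr 1; ext x; rw [mul_comm]; exact h x
    · congr 1; ext x; exact h x⟩

lemma conj_phase_apply (τ : ℝ) (B : Matrix ι ι ℂ) (x y : ι) :
    Unitary.conjStarAlgAut ℂ _ (phase q τ) B x y =
      Complex.exp (-(τ * q x : ℝ) * Complex.I) * B x y *
        Complex.exp ((τ * q y : ℝ) * Complex.I) := by
  rw [Unitary.conjStarAlgAut_apply, phase]
  simp only [Matrix.star_eq_conjTranspose, Matrix.diagonal_conjTranspose, Matrix.mul_diagonal,
    Matrix.diagonal_mul, Pi.star_apply, Complex.star_def]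
  rw [← Complex.exp_conj]
  simp

lemma cfc_conj_unitary (U : unitary (Matrix ι ι ℂ)) {B : Matrix ι ι ℂ} (hB : B.IsHermitian)
    (f : ℝ → ℝ) :
    cfc f (Unitary.conjStarAlgAut ℂ _ U B) = Unitary.conjStarAlgAut ℂ _ U (cfc f B) := by
  refine (StarAlgHomClass.map_cfc (S := ℂ) (Unitary.conjStarAlgAut ℂ _ U) f B ?_ ?_ hB ?_).symm
  · exact B.finite_real_spectrum.continuousOn f
  · change Continuous fun x => (U : Matrix ι ι ℂ) * x * star (U : Matrix ι ι ℂ)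
    fun_prop
  · exact IsSelfAdjoint.map (f := Unitary.conjStarAlgAut ℂ (Matrix ι ι ℂ) U) hB

variable (c q v) in
/-- The tilted symbols are close to the symbol: the hypotheses of the Combes-Thomas estimate. -/
structure TiltBound (R K : ℝ) (w : (Fin d → ℤ) → ι → ι → ℝ) : Prop where
  summable : ∀ x y, Summable fun γ => w γ x y
  norm_le : ∀ z ∈ Metric.ball (0 : ℂ) R, ∀ γ x y, ‖tilt c q v z γ x y‖ ≤ w γ x y
  norm_sub_le : ∀ z ∈ Metric.ball (0 : ℂ) R, ∀ θ,
    ‖symbol (tilt c q v z) θ - symbol c θ‖ ≤ ‖z‖ * K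

variable (c) in
/-- The symbol has a direct gap of width `g` around `μ(θ)`, on the same side of which lies the
Fermi level `εF`. -/
structure DirectGap (μ : UnitAddTorus (Fin d) → ℝ) (εF B g δ : ℝ) : Prop where
  isHermitian : ∀ θ, (symbol c θ).IsHermitian
  continuous : Continuous μ
  gap_pos : 0 < g
  bound_pos : 0 < B
  delta_pos : 0 < δ
  gap_le : g ≤ 4 * B
  norm_le : ∀ θ, ‖symbol c θ‖ ≤ B
  abs_mid_le : ∀ θ, |μ θ| ≤ B
  split : ∀ θ, ∀ r ∈ spectrum ℝ (symbol c θ),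
    (r ≤ μ θ - g / 2 ∧ r ≤ εF - δ) ∨ (μ θ + g / 2 ≤ r ∧ εF + δ ≤ r)

variable {R K : ℝ} {w : (Fin d → ℤ) → ι → ι → ℝ} {μ : UnitAddTorus (Fin d) → ℝ} {εF B g δ : ℝ}

lemma TiltBound.summable_norm (hw : TiltBound c q v R K w) {z : ℂ}
    (hz : z ∈ Metric.ball (0 : ℂ) R) (x y : ι) : Summable fun γ => ‖tilt c q v z γ x y‖ :=
  Summable.of_nonneg_of_le (fun _ => norm_nonneg _) (fun γ => hw.norm_le z hz γ x y)
    (hw.summable x y)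

lemma TiltBound.differentiableOn_symbol (hw : TiltBound c q v R K w)
    (θ : UnitAddTorus (Fin d)) :
    DifferentiableOn ℂ (fun z => symbol (tilt c q v z) θ) (Metric.ball (0 : ℂ) R) := by
  have h1 : ∀ x y, DifferentiableOn ℂ (fun z => symbol (tilt c q v z) θ x y)
      (Metric.ball (0 : ℂ) R) := fun x y => by
    refine Complex.differentiableOn_tsum_of_summable_norm (hw.summable x y) (fun γ => ?_)
      Metric.isOpen_ball fun γ z hz => ?_
    · simp only [tilt]
      fun_prop
    · rw [norm_mul, norm_mFourier_apply, mul_one]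
      exact hw.norm_le z hz γ x y
  have h2 : (fun z => symbol (tilt c q v z) θ) = fun z =>
      ∑ x, ∑ y, symbol (tilt c q v z) θ x y • Matrix.single x y (1 : ℂ) := by
    funext z
    conv_lhs => rw [Matrix.matrix_eq_sum_single (symbol (tilt c q v z) θ)]
    refine Finset.sum_congr rfl fun x _ => Finset.sum_congr rfl fun y _ => ?_
    rw [Matrix.smul_single, smul_eq_mul, mul_one]
  rw [h2]
  exact DifferentiableOn.fun_sum fun x _ => DifferentiableOn.fun_sum fun y _ =>
    (h1 x y).smul_const _

/-- The distance of the contour, the circle with diameter `[μ - 4B, μ]`, to the spectrum. -/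
lemma DirectGap.dist_contour (hg : DirectGap c μ εF B g δ) (θ : UnitAddTorus (Fin d)) {w : ℂ}
    (hw : w ∈ Metric.sphere ((μ θ - 2 * B : ℝ) : ℂ) (2 * B)) {r : ℝ}
    (hr : r ∈ spectrum ℝ (symbol c θ)) : g / 2 ≤ ‖w - (r : ℂ)‖ := by
  have h1 : |r| ≤ B := by
    have : |r| ≤ ‖symbol c θ‖ * ‖(1 : Matrix ι ι ℂ)‖ := by
      simpa using spectrum.norm_le_norm_mul_of_mem hr
    rcases isEmpty_or_nonempty ι with h | h
    · exact absurd hr (by simp [spectrum.of_subsingleton])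
    · rw [norm_one, mul_one] at this
      exact this.trans (hg.norm_le θ)
  have h2 := abs_le.1 (hg.abs_mid_le θ)
  have h1' := abs_le.1 h1
  rw [mem_sphere_iff_norm] at hw
  have h3 : ‖(r : ℂ) - ((μ θ - 2 * B : ℝ) : ℂ)‖ = |r - (μ θ - 2 * B)| := by
    rw [← Complex.ofReal_sub, Complex.norm_real, Real.norm_eq_abs]
  -- Radial distances to the centre suffice. The spectrum and `μ θ` lie in `[-B, B]`, so every `r`
  -- is to the right of the centre and the left side becomes `|μ θ - r|`.
  have h4 : |2 * B - abs (r - (μ θ - 2 * B))| ≤ ‖w - (r : ℂ)‖ := by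
    have := abs_norm_sub_norm_le (w - ((μ θ - 2 * B : ℝ) : ℂ)) ((r : ℂ) - ((μ θ - 2 * B : ℝ) : ℂ))
    rw [hw, h3, sub_sub_sub_cancel_right] at this
    exact this
  refine le_trans ?_ h4
  rw [abs_of_nonneg (by linarith : 0 ≤ r - (μ θ - 2 * B))]
  rcases hg.split θ r hr with h | h
  · rw [abs_of_nonneg (by linarith [hg.gap_pos])]; linarith
  · rw [abs_of_nonpos (by linarith [hg.gap_pos])]; linarith

/-- The contour stays at distance `g / 2` from the spectrum and the tilt costs at most half of it,
leaving `g / 4`. -/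
lemma DirectGap.resolvent_tilt (hg : DirectGap c μ εF B g δ) (hw : TiltBound c q v R K w)
    (hRK : R * K ≤ g / 4) (hK : 0 ≤ K) {z : ℂ} (hz : z ∈ Metric.ball (0 : ℂ) R)
    (θ : UnitAddTorus (Fin d)) {ζ : ℂ}
    (hζ : ζ ∈ Metric.sphere ((μ θ - 2 * B : ℝ) : ℂ) (2 * B)) :
    IsUnit (algebraMap ℂ (Matrix ι ι ℂ) ζ - symbol (tilt c q v z) θ) ∧
      ‖Ring.inverse (algebraMap ℂ (Matrix ι ι ℂ) ζ - symbol (tilt c q v z) θ)‖ ≤ 4 / g := by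
  have h1 : ‖symbol (tilt c q v z) θ - symbol c θ‖ ≤ g / 4 := by
    refine (hw.norm_sub_le z hz θ).trans (le_trans ?_ hRK)
    rw [mem_ball_zero_iff] at hz
    gcongr
  have hgp := hg.gap_pos
  obtain ⟨h2, h3⟩ := isUnit_and_norm_resolvent_le_of_near (hg.isHermitian θ)
    (fun r hr => hg.dist_contour θ hζ hr) (h1.trans_lt (by linarith))
  refine ⟨h2, h3.trans ?_⟩
  rw [show 4 / g = (g / 4)⁻¹ by rw [inv_div]]
  exact inv_anti₀ (by linarith) (by linarith)

open scoped Real in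
/-- The integrand of the contour integral for the Fourier coefficients of the spectral projections
of the tilted symbol. -/
def contourIntegrand (c : (Fin d → ℤ) → ι → ι → ℂ) (q : ι → ℝ) (v : Fin d → ℝ)
    (μ : UnitAddTorus (Fin d) → ℝ) (B : ℝ) (n : Fin d → ℤ) (x y : ι) (z : ℂ)
    (p : UnitAddTorus (Fin d) × ℝ) : ℂ :=
  (2 * π * Complex.I)⁻¹ * (deriv (circleMap ((μ p.1 - 2 * B : ℝ) : ℂ) (2 * B)) p.2 *
    (Ring.inverse (algebraMap ℂ (Matrix ι ι ℂ) (circleMap ((μ p.1 - 2 * B : ℝ) : ℂ) (2 * B) p.2) -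
      symbol (tilt c q v z) p.1)) x y) * mFourier n p.1

lemma circleMap_mem_contour (hg : DirectGap c μ εF B g δ) (p : UnitAddTorus (Fin d) × ℝ) :
    circleMap ((μ p.1 - 2 * B : ℝ) : ℂ) (2 * B) p.2 ∈
      Metric.sphere ((μ p.1 - 2 * B : ℝ) : ℂ) (2 * B) :=
  circleMap_mem_sphere _ (by linarith [hg.bound_pos]) _

section

variable (hg : DirectGap c μ εF B g δ) (hw : TiltBound c q v R K w) (hRK : R * K ≤ g / 4)
  (hK : 0 ≤ K) (n : Fin d → ℤ) (x y : ι)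

include hg hw

/-- On the imaginary axis the Riesz projections of the tilted symbol are conjugate to the spectral
projections of the translated symbol. -/
lemma integral_contourIntegrand_I {τ : ℝ} (hτ : (τ * Complex.I : ℂ) ∈ Metric.ball (0 : ℂ) R)
    (hτδ : |τ| * K < min δ (g / 4)) (θ : UnitAddTorus (Fin d)) :
    ∫ φ in Set.Ioc 0 (2 * Real.pi), contourIntegrand c q v μ B n x y (τ * Complex.I) (θ, φ) =
      Complex.exp (-(τ * q x : ℝ) * Complex.I) *
        (cfc ((Set.Iio εF).indicator (fun _ => (1 : ℝ)))
          (symbol c (θ + fun s => ((τ * v s / (2 * Real.pi) : ℝ) : UnitAddCircle)))) x y *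
          Complex.exp ((τ * q y : ℝ) * Complex.I) * mFourier n θ := by
  set y' : UnitAddTorus (Fin d) := fun s => ((τ * v s / (2 * Real.pi) : ℝ) : UnitAddCircle)
  set b := symbol (tilt c q v (τ * Complex.I)) θ with hb
  have hbc : b = Unitary.conjStarAlgAut ℂ _ (phase q τ) (symbol c (θ + y')) := by
    ext x y
    rw [conj_phase_apply, hb, symbol_tilt_I]
  have hbh : b.IsHermitian := by
    rw [hbc]
    exact IsSelfAdjoint.map (f := Unitary.conjStarAlgAut ℂ (Matrix ι ι ℂ) (phase q τ))
      (hg.isHermitian _)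
  have hnear : ‖b - symbol c θ‖ < min δ (g / 4) := by
    refine (hw.norm_sub_le _ hτ θ).trans_lt ?_
    rwa [norm_mul, Complex.norm_I, mul_one, Complex.norm_real, Real.norm_eq_abs]
  -- An eigenvalue of the tilted symbol is closer than `min δ (g / 4)` to one of the symbol, so it
  -- stays on the same side of both `μ θ` and `εF`. The circle and the Fermi level therefore select
  -- the same eigenvalues. The bound `g ≤ 4 * B` keeps the lower ones inside the circle.
  have hspec : ∀ s ∈ spectrum ℝ b, (s < μ θ ∧ s < εF ∨ μ θ < s ∧ εF < s) ∧
      |s - (μ θ - 2 * B)| ≠ 2 * B ∧ (s < μ θ ↔ |s - (μ θ - 2 * B)| < 2 * B) := by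
    intro s hs
    obtain ⟨r, hr, hrs⟩ := exists_mem_spectrum_abs_sub_le (E := Matrix ι ι ℂ) (hg.isHermitian θ) hs
    have hrs' := abs_lt.1 (hrs.trans_lt hnear)
    have hm1 := min_le_left δ (g / 4)
    have hm2 := min_le_right δ (g / 4)
    have hgp := hg.gap_pos
    have hgB := hg.gap_le
    have hBp := hg.bound_pos
    have hμ := abs_le.1 (hg.abs_mid_le θ)
    have hrB : |r| ≤ B := by
      have : |r| ≤ ‖symbol c θ‖ * ‖(1 : Matrix ι ι ℂ)‖ := by
        simpa using spectrum.norm_le_norm_mul_of_mem hr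
      have : Nonempty ι := ⟨x⟩
      rw [norm_one, mul_one] at *
      exact le_trans ‹_› (hg.norm_le θ)
    have hrB' := abs_le.1 hrB
    rcases hg.split θ r hr with h | h
    · have h1 : |s - (μ θ - 2 * B)| < 2 * B := abs_lt.2 ⟨by linarith, by linarith⟩
      exact ⟨Or.inl ⟨by linarith, by linarith⟩, h1.ne, ⟨fun _ => h1, fun _ => by linarith⟩⟩
    · have h1 : 2 * B < |s - (μ θ - 2 * B)| := lt_of_lt_of_le (by linarith) (le_abs_self _)
      exact ⟨Or.inr ⟨by linarith, by linarith⟩, h1.ne',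
        ⟨fun h' => by linarith, fun h' => by linarith⟩⟩
  have h1 := circleIntegral_resolvent_entry hbh (c := μ θ - 2 * B) (R := 2 * B)
    (by linarith [hg.bound_pos]) (fun r hr => (hspec r hr).2.1) x y
  have h2 : cfc ({s | |s - (μ θ - 2 * B)| < 2 * B}.indicator (fun _ => (1 : ℝ))) b
      = cfc ((Set.Iio εF).indicator (fun _ => (1 : ℝ))) b := by
    refine cfc_congr fun s hs => ?_
    obtain ⟨h3, -, h5⟩ := hspec s hs
    rcases h3 with h | h
    · rw [Set.indicator_of_mem (by exact h5.1 h.1), Set.indicator_of_mem (by exact h.2)]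
    · have h6 : s ∉ {s | |s - (μ θ - 2 * B)| < 2 * B} := fun h' => absurd (h5.2 h') h.1.not_gt
      rw [Set.indicator_of_notMem h6,
        Set.indicator_of_notMem (by simpa using h.2.le)]
  rw [h2, hbc, cfc_conj_unitary _ (hg.isHermitian _), conj_phase_apply, ← hbc, circleIntegral,
    intervalIntegral.integral_of_le Real.two_pi_pos.le] at h1
  simp only [contourIntegrand]
  rw [integral_mul_const, integral_const_mul]
  congr 1
  simp only [smul_eq_mul] at h1
  rw [← hb, h1, ← mul_assoc, inv_mul_cancel₀ Complex.two_pi_I_ne_zero, one_mul]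

include hRK hK

lemma continuous_contourIntegrand {z : ℂ} (hz : z ∈ Metric.ball (0 : ℂ) R) :
    Continuous (contourIntegrand c q v μ B n x y z) := by
  have hμ := hg.continuous
  have hs : Continuous fun p : UnitAddTorus (Fin d) × ℝ => symbol (tilt c q v z) p.1 :=
    (continuous_symbol (hw.summable_norm hz)).comp continuous_fst
  have hcm : Continuous fun p : UnitAddTorus (Fin d) × ℝ =>
      circleMap ((μ p.1 - 2 * B : ℝ) : ℂ) (2 * B) p.2 := by
    simp only [circleMap]
    fun_prop
  have hsub : Continuous fun p : UnitAddTorus (Fin d) × ℝ =>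
      algebraMap ℂ (Matrix ι ι ℂ) (circleMap ((μ p.1 - 2 * B : ℝ) : ℂ) (2 * B) p.2) -
        symbol (tilt c q v z) p.1 :=
    ((continuous_algebraMap ℂ (Matrix ι ι ℂ)).comp hcm).sub hs
  have hinv : Continuous fun p : UnitAddTorus (Fin d) × ℝ =>
      Ring.inverse (algebraMap ℂ (Matrix ι ι ℂ)
        (circleMap ((μ p.1 - 2 * B : ℝ) : ℂ) (2 * B) p.2) - symbol (tilt c q v z) p.1) := by
    refine continuous_iff_continuousAt.2 fun p => ?_
    obtain ⟨u, hu⟩ := (hg.resolvent_tilt hw hRK hK hz p.1 (circleMap_mem_contour hg p)).1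
    refine ContinuousAt.comp (g := Ring.inverse) ?_ hsub.continuousAt
    rw [← hu]
    exact NormedRing.inverse_continuousAt u
  have h1 := continuous_entry hinv x y
  change Continuous fun p => contourIntegrand c q v μ B n x y z p
  simp only [contourIntegrand, deriv_circleMap]
  have h2 : Continuous fun p : UnitAddTorus (Fin d) × ℝ => circleMap 0 (2 * B) p.2 :=
    (continuous_circleMap 0 (2 * B)).comp continuous_snd
  fun_prop

lemma norm_contourIntegrand_le {z : ℂ} (hz : z ∈ Metric.ball (0 : ℂ) R)
    (p : UnitAddTorus (Fin d) × ℝ) :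
    ‖contourIntegrand c q v μ B n x y z p‖ ≤ (2 * Real.pi)⁻¹ * (2 * B * (4 / g)) := by
  have hB := hg.bound_pos
  have h1 := (hg.resolvent_tilt hw hRK hK hz p.1 (circleMap_mem_contour hg p)).2
  have h2 := (norm_entry_le_l2_opNorm _ x y).trans h1
  rw [contourIntegrand, norm_mul, norm_mul, norm_mul, norm_mFourier_apply, mul_one]
  have h3 : ‖(2 * Real.pi * Complex.I)⁻¹‖ = (2 * Real.pi)⁻¹ := by
    simp [abs_of_pos Real.pi_pos]
  have h4 : ‖deriv (circleMap ((μ p.1 - 2 * B : ℝ) : ℂ) (2 * B)) p.2‖ = 2 * B := by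
    rw [deriv_circleMap, norm_mul, Complex.norm_I, mul_one, norm_circleMap_zero,
      abs_of_pos (by linarith)]
  rw [h3, h4]
  gcongr

lemma differentiableOn_contourIntegrand (p : UnitAddTorus (Fin d) × ℝ) :
    DifferentiableOn ℂ (fun z => contourIntegrand c q v μ B n x y z p)
      (Metric.ball (0 : ℂ) R) := by
  have h1 : DifferentiableOn ℂ (fun z => Ring.inverse (algebraMap ℂ (Matrix ι ι ℂ)
      (circleMap ((μ p.1 - 2 * B : ℝ) : ℂ) (2 * B) p.2) - symbol (tilt c q v z) p.1))
      (Metric.ball (0 : ℂ) R) := by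
    intro z hz
    have hu := (hg.resolvent_tilt hw hRK hK hz p.1 (circleMap_mem_contour hg p)).1
    exact (differentiableAt_inverse (𝕜 := ℂ) hu).comp_differentiableWithinAt z
      ((differentiableOn_const _).sub (hw.differentiableOn_symbol p.1) z hz)
  let L : Matrix ι ι ℂ →ₗ[ℂ] ℂ :=
    { toFun := fun T => T x y, map_add' := fun _ _ => rfl, map_smul' := fun _ _ => rfl }
  have h2 : DifferentiableOn ℂ (fun z => (Ring.inverse (algebraMap ℂ (Matrix ι ι ℂ)
      (circleMap ((μ p.1 - 2 * B : ℝ) : ℂ) (2 * B) p.2) - symbol (tilt c q v z) p.1)) x y)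
      (Metric.ball (0 : ℂ) R) :=
    (LinearMap.toContinuousLinearMap L).differentiable.comp_differentiableOn h1
  simp only [contourIntegrand]
  exact ((h2.const_mul _).const_mul _).mul_const _

/-- The **Combes-Thomas estimate** for translation-invariant operators with a direct gap: the
Fourier coefficients of the spectral projections of the symbol decay exponentially. -/
theorem norm_integral_cfc_symbol_le (hR : 0 < R) {η : ℝ} (hη0 : 0 ≤ η) (hη : η < R) :
    ‖∫ θ, (cfc ((Set.Iio εF).indicator (fun _ => (1 : ℝ))) (symbol c θ)) x y * mFourier n θ‖ ≤
      8 * B / g * Real.exp (-η * (q x - q y + ∑ s, v s * n s)) := by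
  set ρ := ∫ θ, (cfc ((Set.Iio εF).indicator (fun _ => (1 : ℝ))) (symbol c θ)) x y * mFourier n θ
    with hρ
  set ν : Measure (UnitAddTorus (Fin d) × ℝ) :=
    (volume : Measure (UnitAddTorus (Fin d))).prod (volume.restrict (Set.Ioc 0 (2 * Real.pi)))
    with hν
  set F : ℂ → ℂ := fun z => ∫ p, contourIntegrand c q v μ B n x y z p ∂ν with hF
  have hmeas : ∀ z ∈ Metric.ball (0 : ℂ) R,
      AEStronglyMeasurable (contourIntegrand c q v μ B n x y z) ν := fun z hz =>
    (continuous_contourIntegrand hg hw hRK hK n x y hz).aestronglyMeasurable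
  have hbd := fun z (hz : z ∈ Metric.ball (0 : ℂ) R) =>
    norm_contourIntegrand_le hg hw hRK hK n x y hz
  have hFd : DifferentiableOn ℂ F (Metric.ball (0 : ℂ) R) :=
    differentiableOn_integral_of_bounded hmeas
      (differentiableOn_contourIntegrand hg hw hRK hK n x y) hbd
  have hνu : ν.real Set.univ = 2 * Real.pi := by
    rw [hν, ← Set.univ_prod_univ, measureReal_prod_prod]
    simp [Measure.real, Real.pi_pos.le]
  -- Circumference `4πB`, resolvent bound `4 / g` and prefactor `1 / (2π)`.
  have hFb : ∀ z ∈ Metric.ball (0 : ℂ) R, ‖F z‖ ≤ 8 * B / g := by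
    intro z hz
    refine (norm_integral_le_of_norm_le_const (Filter.Eventually.of_forall (hbd z hz))).trans
      (le_of_eq ?_)
    rw [hνu]
    field_simp
    ring
  set U : ℝ := q x - q y + ∑ s, v s * n s with hU
  -- Translating the integration variable by `y'` undoes the translation of the symbol. The
  -- character then contributes its value at `y'`, which combines with the phases of `q` to `exp
  -- (-iτU)`.
  have hFI : ∀ τ : ℝ, (τ * Complex.I : ℂ) ∈ Metric.ball (0 : ℂ) R → |τ| * K < min δ (g / 4) →
      F (τ * Complex.I) = Complex.exp (-(τ * Complex.I) * (U : ℂ)) * ρ := by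
    intro τ hτ hτδ
    set y' : UnitAddTorus (Fin d) := fun s => ((τ * v s / (2 * Real.pi) : ℝ) : UnitAddCircle)
      with hy'
    have hint : Integrable (contourIntegrand c q v μ B n x y (τ * Complex.I)) ν :=
      Integrable.of_bound (hmeas _ hτ) _ (Filter.Eventually.of_forall (hbd _ hτ))
    rw [hF]
    simp only
    rw [integral_prod _ hint]
    simp only [integral_contourIntegrand_I hg hw n x y hτ hτδ]
    rw [hρ, ← integral_add_right_eq_self (μ := volume) (fun θ =>
      (cfc ((Set.Iio εF).indicator (fun _ => (1 : ℝ))) (symbol c θ)) x y * mFourier n θ) y',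
      ← integral_const_mul]
    refine integral_congr_ae (Filter.Eventually.of_forall fun θ => ?_)
    simp only
    rw [mFourier_apply_add n θ y', hy', mFourier_apply_coe]
    have h1 : Complex.exp (-(τ * Complex.I) * (U : ℂ)) * Complex.exp (Complex.I *
          ((2 * Real.pi * ∑ s, (n s : ℝ) * (τ * v s / (2 * Real.pi)) : ℝ) : ℂ))
        = Complex.exp (-(τ * q x : ℝ) * Complex.I) * Complex.exp ((τ * q y : ℝ) * Complex.I) := by
      rw [← Complex.exp_add, ← Complex.exp_add]
      congr 1
      have : 2 * Real.pi * ∑ s, (n s : ℝ) * (τ * v s / (2 * Real.pi)) = τ * ∑ s, v s * n s := by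
        rw [Finset.mul_sum, Finset.mul_sum]
        refine Finset.sum_congr rfl fun s _ => ?_
        have := Real.pi_ne_zero
        field_simp
      rw [this, hU]
      push_cast
      ring
    linear_combination (-(cfc ((Set.Iio εF).indicator (fun _ => (1 : ℝ)))
      (symbol c (θ + fun s => ((τ * v s / (2 * Real.pi) : ℝ) : UnitAddCircle)))) x y *
        mFourier n θ) * h1
  -- The formula is known only for small imaginary `z`, with a threshold depending on `δ`. These
  -- points accumulate at `0`, which is enough for the identity theorem, so `δ` does not enter the
  -- final bound.
  have hfreq : ∃ᶠ z in nhdsWithin (0 : ℂ) {0}ᶜ, F z = Complex.exp (-z * (U : ℂ)) * ρ := by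
    have ht : Filter.Tendsto (fun τ : ℝ => (τ * Complex.I : ℂ)) (nhdsWithin 0 {0}ᶜ)
        (nhdsWithin 0 {0}ᶜ) := by
      refine tendsto_nhdsWithin_of_tendsto_nhds_of_eventually_within _ ?_ ?_
      · have : Continuous fun τ : ℝ => (τ * Complex.I : ℂ) := by fun_prop
        simpa using (this.tendsto 0).mono_left nhdsWithin_le_nhds
      · filter_upwards [self_mem_nhdsWithin] with τ hτ
        simpa using hτ
    refine ht.frequently (Filter.Eventually.frequently ?_)
    have e1 : ∀ᶠ τ : ℝ in nhdsWithin 0 {0}ᶜ, (τ * Complex.I : ℂ) ∈ Metric.ball (0 : ℂ) R :=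
      (ht.mono_right nhdsWithin_le_nhds).eventually (Metric.ball_mem_nhds 0 hR)
    have e2 : ∀ᶠ τ : ℝ in nhdsWithin 0 {0}ᶜ, |τ| * K < min δ (g / 4) := by
      have : Continuous fun τ : ℝ => |τ| * K := by fun_prop
      have h0 := (this.tendsto 0).mono_left (nhdsWithin_le_nhds (s := {0}ᶜ))
      rw [abs_zero, zero_mul] at h0
      exact h0.eventually (gt_mem_nhds (lt_min hg.delta_pos (by linarith [hg.gap_pos])))
    filter_upwards [e1, e2] with τ h1 h2 using hFI τ h1 h2
  have hEq := (hFd.analyticOnNhd Metric.isOpen_ball).eqOn_of_preconnected_of_frequently_eq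
    (DifferentiableOn.analyticOnNhd (s := Metric.ball (0 : ℂ) R)
      (f := fun z => Complex.exp (-z * (U : ℂ)) * ρ) (by fun_prop) Metric.isOpen_ball)
    (convex_ball (0 : ℂ) R).isPreconnected (Metric.mem_ball_self hR) hfreq
  -- At `z = -η` the factor `exp (-z * U)` is `exp (η * U)`, and the bound on `F` becomes decay of
  -- `ρ`.
  have hmem : ((-η : ℝ) : ℂ) ∈ Metric.ball (0 : ℂ) R := by
    rw [mem_ball_zero_iff, Complex.norm_real, Real.norm_eq_abs, abs_neg, abs_of_nonneg hη0]
    exact hη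
  have h1 := hFb _ hmem
  rw [hEq hmem] at h1
  simp only at h1
  rw [norm_mul, Complex.norm_exp] at h1
  have h2 : (-((-η : ℝ) : ℂ) * (U : ℂ)).re = η * U := by
    rw [← Complex.ofReal_neg, ← Complex.ofReal_mul, Complex.ofReal_re]
    ring
  rw [h2] at h1
  rw [neg_mul, Real.exp_neg, ← div_eq_mul_inv, le_div_iff₀ (Real.exp_pos _), mul_comm]
  exact h1

end

end Tilt

/-! ### The Hamiltonian as a bounded self-adjoint operator and its Fourier coefficients -/

namespace Multilattice

variable {d M : ℕ} {S : Type*} (L : Multilattice d M S)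

lemma vec_sub (α β : Fin d → ℤ) : L.vec (α - β) = L.vec α - L.vec β := by
  rw [sub_eq_add_neg, vec_add, vec_neg, ← sub_eq_add_neg]

lemma vec_injective : Function.Injective L.vec := by
  intro α β h
  have h1 : L.A *ᵥ (fun s => (α s : ℝ)) = L.A *ᵥ (fun s => (β s : ℝ)) := WithLp.toLp_injective 2 h
  have h2 := Matrix.mulVec_injective_of_isUnit
    ((Matrix.isUnit_iff_isUnit_det _).2 (isUnit_iff_ne_zero.2 L.det_ne_zero)) h1
  ext s
  exact_mod_cast congrFun h2 s

lemma coe_site (i : Fin M) (α : Fin d → ℤ) : (L.site i α : Space d) = L.shift i + L.vec α := rfl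

lemma site_bijective : Function.Bijective fun r : Fin M × (Fin d → ℤ) => L.site r.1 r.2 := by
  constructor
  · rintro ⟨i, α⟩ ⟨j, β⟩ h
    have h1 : L.shift i + L.vec α = L.shift j + L.vec β := congrArg Subtype.val h
    have hij : i = j := by
      by_contra hij
      refine L.shift_distinct i j hij (β - α) ?_
      change _ = L.vec _
      rw [vec_sub, sub_eq_sub_iff_add_eq_add, h1, add_comm]
    subst hij
    rw [L.vec_injective (add_left_cancel h1)]
  · rintro ⟨x, i, α, hx⟩
    exact ⟨(i, α), Subtype.ext hx.symm⟩

/-- The orbitals of a multilattice, indexed by the orbitals in the unit cell and the lattice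
vectors. -/
def orbitalEquiv (Nb : ℕ) : (Fin M × Fin Nb) × (Fin d → ℤ) ≃ L.sites × Fin Nb :=
  (Equiv.prodAssoc _ _ _).trans <| ((Equiv.refl _).prodCongr (Equiv.prodComm _ _)).trans <|
    (Equiv.prodAssoc _ _ _).symm.trans <|
      (Equiv.ofBijective _ L.site_bijective).prodCongr (Equiv.refl _)

variable {L} {m : ℝ}

lemma site_eq_translate (i : Fin M) (α β : Fin d → ℤ) :
    L.site i (α + β) = L.translate β (L.site i α) := by
  ext1
  simp [translate, coe_site, vec_add, add_assoc]

open scoped Classical in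
/-- A weight that is `D` on the diagonal and decays exponentially off the diagonal. -/
def expWeight (D γ : ℝ) (ℓ k : L.sites) : ℝ :=
  if k = ℓ then D else Real.exp (-γ * ‖(ℓ : Space d) - k‖)

lemma expWeight_nonneg {D : ℝ} (hD : 0 ≤ D) (γ : ℝ) (ℓ k : L.sites) : 0 ≤ expWeight D γ ℓ k := by
  unfold expWeight
  split_ifs
  exacts [hD, (Real.exp_pos _).le]

lemma sum_expWeight_le (hm : 0 < m) (hL : L.Separated m) {D γ : ℝ} (hD : 0 ≤ D) (hγ : 0 < γ)
    (ℓ : L.sites) (u : Finset L.sites) :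
    ∑ k ∈ u, expWeight D γ ℓ k ≤ D + expSumConst d m * γ⁻¹ ^ d := by
  classical
  rw [← Finset.sum_filter_add_sum_filter_not u (· = ℓ)]
  refine add_le_add ?_ ?_
  · calc ∑ k ∈ u with k = ℓ, expWeight D γ ℓ k ≤ ∑ k ∈ {ℓ}, expWeight D γ ℓ k := by
          refine Finset.sum_le_sum_of_subset_of_nonneg (fun k hk => ?_)
            fun k _ _ => expWeight_nonneg hD γ ℓ k
          exact Finset.mem_singleton.2 (Finset.mem_filter.1 hk).2
      _ = D := by simp [expWeight]
  · rw [← Finset.sum_subtype_eq_sum_filter]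
    refine (le_of_eq (Finset.sum_congr rfl fun k _ => ?_)).trans
      (sum_exp_neg_le hm hL hγ ℓ (u.subtype fun k => ¬k = ℓ))
    rw [expWeight, if_neg k.2]

lemma expWeight_comm (D γ : ℝ) (ℓ k : L.sites) : expWeight D γ ℓ k = expWeight D γ k ℓ := by
  unfold expWeight
  simp only [eq_comm (a := k), norm_sub_rev (k : Space d)]

lemma sum_expWeight_site_le (hm : 0 < m) (hL : L.Separated m) {D γ : ℝ} (hD : 0 ≤ D)
    (hγ : 0 < γ) (i : Fin M) (k : L.sites) (u : Finset (Fin d → ℤ)) :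
    ∑ α ∈ u, expWeight D γ (L.site i α) k ≤ D + expSumConst d m * γ⁻¹ ^ d := by
  have hinj : Function.Injective (L.site i) := fun α β h =>
    (Prod.ext_iff.1 (L.site_bijective.injective (a₁ := (i, α)) (a₂ := (i, β)) h)).2
  refine le_trans (le_of_eq ?_) (sum_expWeight_le hm hL hD hγ k (u.map ⟨L.site i, hinj⟩))
  rw [Finset.sum_map]
  exact Finset.sum_congr rfl fun α _ => expWeight_comm _ _ _ _

lemma summable_expWeight_site (hm : 0 < m) (hL : L.Separated m) {D γ : ℝ} (hD : 0 ≤ D)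
    (hγ : 0 < γ) (i : Fin M) (k : L.sites) :
    Summable fun α => expWeight D γ (L.site i α) k :=
  summable_of_sum_le (fun _ => expWeight_nonneg hD γ _ k)
    (sum_expWeight_site_le hm hL hD hγ i k)

lemma tsum_expWeight_site_le (hm : 0 < m) (hL : L.Separated m) {D γ : ℝ} (hD : 0 ≤ D)
    (hγ : 0 < γ) (i : Fin M) (k : L.sites) :
    ∑' α, expWeight D γ (L.site i α) k ≤ D + expSumConst d m * γ⁻¹ ^ d :=
  Real.tsum_le_of_sum_le (fun _ => expWeight_nonneg hD γ _ k)
    (sum_expWeight_site_le hm hL hD hγ i k)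

variable {Nb : ℕ} {h t : Fin Nb → Fin Nb → Space d → S → S → ℝ} {h₀ γ₀ : ℝ}

/-- The on-site sum of the `t` terms affects only the diagonal, where it adds `expSumConst d m *
γ₀⁻¹ ^ d` to the `1` coming from `h`. -/
lemma TB.abs_hamEntry_le (H : L.TB h t h₀ γ₀) (hm : 0 < m) (hL : L.Separated m) (hh : 0 < h₀)
    (hγ : 0 < γ₀) (ℓ k : L.sites) (a b : Fin Nb) :
    |L.hamEntry h t ℓ k a b| ≤
      h₀ * expWeight (1 + expSumConst d m * γ₀⁻¹ ^ d) γ₀ ℓ k := by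
  have hhb : ∀ ℓ k : L.sites, |h a b ((ℓ : Space d) - k) (L.z ℓ) (L.z k)|
      ≤ h₀ * Real.exp (-γ₀ * ‖(ℓ : Space d) - k‖) := fun ℓ k =>
    (le_add_of_nonneg_right (norm_nonneg _)).trans (H.h_decay a b ℓ k)
  have htb : ∀ ℓ k : L.sites, |t a b ((ℓ : Space d) - k) (L.z ℓ) (L.z k)|
      ≤ h₀ * Real.exp (-γ₀ * ‖(ℓ : Space d) - k‖) := fun ℓ k =>
    (le_add_of_nonneg_right (norm_nonneg _)).trans (H.t_decay a b ℓ k)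
  by_cases e : ℓ = k
  · subst e
    simp only [hamEntry, if_true, expWeight]
    have h1 := hhb ℓ ℓ
    rw [sub_self, norm_zero, mul_zero, Real.exp_zero, mul_one] at h1
    have h2 : ‖∑' m : {m : L.sites // m ≠ ℓ}, t a b ((ℓ : Space d) - (m : L.sites)) (L.z ℓ)
        (L.z m)‖ ≤ h₀ * ∑' m : {m : L.sites // m ≠ ℓ},
          Real.exp (-γ₀ * ‖(ℓ : Space d) - (m : L.sites)‖) :=
      tsum_of_norm_bounded ((summable_exp_neg hm hL hγ ℓ).hasSum.mul_left h₀) fun k => htb ℓ k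
    have h3 := mul_le_mul_of_nonneg_left (tsum_exp_neg_le hm hL hγ ℓ) hh.le
    rw [Real.norm_eq_abs] at h2
    rw [sub_self]
    refine (abs_add_le _ _).trans ?_
    linarith
  · simp only [hamEntry, if_neg e, expWeight, if_neg (Ne.symm e), add_zero]
    exact hhb ℓ k

theorem TB.isHamiltonian (H : L.TB h t h₀ γ₀) (hm : 0 < m) (hL : L.Separated m) (hh : 0 < h₀)
    (hγ : 0 < γ₀) : L.IsHamiltonian h t (L.hamiltonian h t) := by
  set s := expSumConst d m
  have hs : 0 ≤ s := expSumConst_nonneg m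
  have hD : 0 ≤ 1 + s * γ₀⁻¹ ^ d := by positivity
  set C : ℝ := h₀ * (1 + s * γ₀⁻¹ ^ d + s * γ₀⁻¹ ^ d) * Nb
  have hrow : ∀ (p : L.sites × Fin Nb) (u : Finset (L.sites × Fin Nb)),
      ∑ r ∈ u, ‖(L.hamEntry h t p.1 r.1 p.2 r.2 : ℂ)‖ ≤ C := by
    classical
    intro p u
    calc ∑ r ∈ u, ‖(L.hamEntry h t p.1 r.1 p.2 r.2 : ℂ)‖
        ≤ ∑ r ∈ u, h₀ * expWeight (1 + s * γ₀⁻¹ ^ d) γ₀ p.1 r.1 := by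
          refine Finset.sum_le_sum fun r _ => ?_
          rw [Complex.norm_real]
          exact H.abs_hamEntry_le hm hL hh hγ _ _ _ _
      -- Enlarging the finite set to a product splits off the sum over orbitals as a factor `Nb`.
      _ ≤ ∑ r ∈ u.image Prod.fst ×ˢ (Finset.univ : Finset (Fin Nb)),
            h₀ * expWeight (1 + s * γ₀⁻¹ ^ d) γ₀ p.1 r.1 := by
          refine Finset.sum_le_sum_of_subset_of_nonneg (fun r hr => ?_) fun r _ _ =>
            mul_nonneg hh.le (expWeight_nonneg hD _ _ _)
          exact Finset.mem_product.2 ⟨Finset.mem_image_of_mem _ hr, Finset.mem_univ _⟩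
      _ = h₀ * (∑ k ∈ u.image Prod.fst, expWeight (1 + s * γ₀⁻¹ ^ d) γ₀ p.1 k) * Nb := by
          rw [Finset.sum_product]
          simp only [Finset.sum_const, Finset.card_univ, Fintype.card_fin, nsmul_eq_mul]
          rw [Finset.mul_sum, Finset.sum_mul]
          exact Finset.sum_congr rfl fun k _ => mul_comm _ _
      _ ≤ C := by
          exact mul_le_mul_of_nonneg_right (mul_le_mul_of_nonneg_left
            (sum_expWeight_le hm hL hD hγ p.1 (u.image Prod.fst)) hh.le) (Nat.cast_nonneg _)
  have hcol : ∀ (p : L.sites × Fin Nb) (u : Finset (L.sites × Fin Nb)),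
      ∑ r ∈ u, ‖(L.hamEntry h t r.1 p.1 r.2 p.2 : ℂ)‖ ≤ C := fun p u => by
    simpa only [H.hamEntry_symm L p.1] using hrow p u
  classical
  obtain ⟨T, hT⟩ := exists_clm_of_schur (by positivity) hrow hcol
  have hex : ∃ T, L.IsHamiltonian h t T := ⟨T, fun ℓ k a b => hT (ℓ, a) (k, b)⟩
  rw [hamiltonian, dif_pos hex]
  exact hex.choose_spec

lemma IsHamiltonian.isSelfAdjoint (H : L.TB h t h₀ γ₀) {T : L.Hilb Nb →L[ℂ] L.Hilb Nb}
    (hT : L.IsHamiltonian h t T) : IsSelfAdjoint T := by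
  classical
  refine isSelfAdjoint_of_entries fun ⟨ℓ, a⟩ ⟨k, b⟩ => ?_
  refine (hT ℓ k a b).trans (Eq.trans ?_ (congrArg star (hT k ℓ b a)).symm)
  rw [H.hamEntry_symm L ℓ, Complex.star_def, Complex.conj_ofReal]

variable (L) in
/-- The Fourier coefficients of the symbol of the Hamiltonian. -/
def coef (h t : Fin Nb → Fin Nb → Space d → S → S → ℝ) (γ : Fin d → ℤ)
    (x y : Fin M × Fin Nb) : ℂ :=
  L.hamEntry h t (L.site x.1 γ) (L.site y.1 0) x.2 y.2

lemma coef_sub (h t : Fin Nb → Fin Nb → Space d → S → S → ℝ) (α β : Fin d → ℤ)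
    (x y : Fin M × Fin Nb) :
    L.coef h t (α - β) x y = L.hamEntry h t (L.site x.1 α) (L.site y.1 β) x.2 y.2 := by
  have h1 := L.hamEntry_translate (h := h) (t := t) β (L.site x.1 (α - β)) (L.site y.1 0) x.2 y.2
  rw [← site_eq_translate, ← site_eq_translate, sub_add_cancel, zero_add] at h1
  rw [coef, h1]

lemma TB.star_coef (H : L.TB h t h₀ γ₀) (γ : Fin d → ℤ) (x y : Fin M × Fin Nb) :
    star (L.coef h t γ y x) = L.coef h t (-γ) x y := by
  rw [← zero_sub, coef_sub, coef, H.hamEntry_symm L, Complex.star_def, Complex.conj_ofReal]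

variable (L) in
/-- The shift of an orbital in the unit cell in the direction `e`. -/
def shiftAlong (e : Space d) (x : Fin M × Fin Nb) : ℝ := ⟪e, L.shift x.1⟫_ℝ

variable (L) in
/-- The coordinates of the lattice vectors in the direction `e`. -/
def vecAlong (e : Space d) (s : Fin d) : ℝ := ⟪e, L.vec (Pi.single s 1)⟫_ℝ

lemma sum_vecAlong (e : Space d) (γ : Fin d → ℤ) :
    ∑ s, L.vecAlong e s * γ s = ⟪e, L.vec γ⟫_ℝ := by
  have : L.vec γ = ∑ s, (γ s : ℝ) • L.vec (Pi.single s 1) := by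
    ext r
    simp only [vec, latticeVec, Matrix.mulVec, dotProduct, WithLp.ofLp_sum, WithLp.ofLp_smul,
      Finset.sum_apply, Pi.smul_apply, smul_eq_mul]
    refine Finset.sum_congr rfl fun s _ => ?_
    rw [Finset.sum_eq_single s]
    · simp [mul_comm]
    · intro r' _ hr'
      simp [Pi.single_eq_of_ne hr']
    · simp
  rw [this, inner_sum]
  refine Finset.sum_congr rfl fun s _ => ?_
  rw [real_inner_smul_right, vecAlong, mul_comm]

lemma displacement_eq (e : Space d) (α β : Fin d → ℤ) (x y : Fin M × Fin Nb) :
    L.shiftAlong e x - L.shiftAlong e y + ∑ s, L.vecAlong e s * (α - β) s =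
      ⟪e, (L.site x.1 α : Space d) - L.site y.1 β⟫_ℝ := by
  have h1 := sum_vecAlong (L := L) e (α - β)
  rw [h1, shiftAlong, shiftAlong, ← inner_sub_right, ← inner_add_right, vec_sub, coe_site, coe_site]
  congr 1
  abel

end Multilattice

/-! ### Norm and tilt bounds for the symbol; the Bloch Hamiltonian -/

namespace Multilattice

open scoped Matrix.Norms.L2Operator

variable {d M : ℕ} {S : Type*} {L : Multilattice d M S} {m : ℝ} {Nb : ℕ}
  {h t : Fin Nb → Fin Nb → Space d → S → S → ℝ} {h₀ γ₀ : ℝ}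

lemma expWeight_mul_exp_le (D : ℝ) {γ : ℝ} (hγ : 0 < γ) (ℓ k : L.sites) :
    expWeight D γ ℓ k * Real.exp (γ / 4 * ‖(ℓ : Space d) - k‖) ≤ expWeight D (γ / 2) ℓ k := by
  unfold expWeight
  split_ifs with e
  · subst e
    simp
  · rw [← Real.exp_add]
    refine Real.exp_le_exp.2 ?_
    nlinarith [norm_nonneg ((ℓ : Space d) - k)]

/-- Of the rate `γ`, one quarter pays for the tilt and one quarter for the linear factor, leaving `γ
/ 2`. The linear factor vanishes on the diagonal, so `D` is replaced by `0`. -/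
lemma expWeight_mul_norm_mul_exp_le (D : ℝ) {γ : ℝ} (hγ : 0 < γ) (ℓ k : L.sites) :
    expWeight D γ ℓ k * (‖(ℓ : Space d) - k‖ * Real.exp (γ / 4 * ‖(ℓ : Space d) - k‖)) ≤
      4 / γ * expWeight 0 (γ / 2) ℓ k := by
  unfold expWeight
  split_ifs with e
  · subst e
    simp
  · set r := ‖(ℓ : Space d) - k‖
    have h1 : r ≤ 4 / γ * Real.exp (γ / 4 * r) := by
      have := (Real.add_one_le_exp (γ / 4 * r))
      have h2 : r = 4 / γ * (γ / 4 * r) := by field_simp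
      calc r = 4 / γ * (γ / 4 * r) := h2
        _ ≤ _ := by gcongr; linarith
    calc Real.exp (-γ * r) * (r * Real.exp (γ / 4 * r))
        ≤ Real.exp (-γ * r) * (4 / γ * Real.exp (γ / 4 * r) * Real.exp (γ / 4 * r)) := by gcongr
      _ = 4 / γ * Real.exp (-(γ / 2) * r) := by
        rw [mul_assoc, ← Real.exp_add, mul_left_comm, ← Real.exp_add]
        congr 2
        ring

lemma sum_sum_le_card_sq_mul {f : Fin M × Fin Nb → Fin M × Fin Nb → ℝ} {C : ℝ}
    (hf : ∀ x y, f x y ≤ C) : ∑ x, ∑ y, f x y ≤ ((M * Nb : ℕ) : ℝ) ^ 2 * C := by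
  calc ∑ x, ∑ y, f x y ≤ ∑ _x : Fin M × Fin Nb, ∑ _y : Fin M × Fin Nb, C :=
        Finset.sum_le_sum fun x _ => Finset.sum_le_sum fun y _ => hf x y
    _ = _ := by
        simp only [Finset.sum_const, Finset.card_univ, Fintype.card_prod, Fintype.card_fin,
          nsmul_eq_mul]
        ring

section

variable (H : L.TB h t h₀ γ₀) (hm : 0 < m) (hL : L.Separated m) (hh : 0 < h₀) (hγ : 0 < γ₀)

include H hm hL hh hγ

lemma TB.norm_coef_le (γ : Fin d → ℤ) (x y : Fin M × Fin Nb) :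
    ‖L.coef h t γ x y‖ ≤
      h₀ * expWeight (1 + expSumConst d m * γ₀⁻¹ ^ d) γ₀ (L.site x.1 γ) (L.site y.1 0) := by
  rw [coef, Complex.norm_real]
  exact H.abs_hamEntry_le hm hL hh hγ _ _ _ _

lemma TB.summable_norm_coef (x y : Fin M × Fin Nb) : Summable fun γ => ‖L.coef h t γ x y‖ := by
  have hs : 0 ≤ expSumConst d m := expSumConst_nonneg m
  exact Summable.of_nonneg_of_le (fun _ => norm_nonneg _)
    (fun γ => H.norm_coef_le hm hL hh hγ γ x y)
    ((summable_expWeight_site hm hL (by positivity) hγ x.1 (L.site y.1 0)).mul_left h₀)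

lemma TB.norm_symbol_coef_le (θ : UnitAddTorus (Fin d)) :
    ‖symbol (L.coef h t) θ‖ ≤ ((M * Nb : ℕ) : ℝ) ^ 2 *
      (h₀ * (1 + 2 * expSumConst d m * γ₀⁻¹ ^ d)) := by
  have hs : 0 ≤ expSumConst d m := expSumConst_nonneg m
  refine (norm_symbol_le (H.summable_norm_coef hm hL hh hγ) θ).trans
    (sum_sum_le_card_sq_mul fun x y => ?_)
  refine (Summable.tsum_le_tsum (fun γ => H.norm_coef_le hm hL hh hγ γ x y)
    (H.summable_norm_coef hm hL hh hγ x y)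
    ((summable_expWeight_site hm hL (by positivity) hγ x.1 (L.site y.1 0)).mul_left h₀)).trans ?_
  rw [tsum_mul_left]
  refine mul_le_mul_of_nonneg_left ((tsum_expWeight_site_le hm hL (by positivity) hγ x.1
    (L.site y.1 0)).trans (le_of_eq ?_)) hh.le
  ring

/-- The tilted symbols of the Hamiltonian. -/
lemma TB.tiltBound {e : Space d} (he : ‖e‖ ≤ 1) {R : ℝ} (hR : R ≤ γ₀ / 4) :
    TiltBound (L.coef h t) (L.shiftAlong e) (L.vecAlong e) R
      (((M * Nb : ℕ) : ℝ) ^ 2 * (h₀ * (4 / γ₀) * (expSumConst d m * (γ₀ / 2)⁻¹ ^ d)))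
      (fun γ x y => h₀ * expWeight (1 + expSumConst d m * γ₀⁻¹ ^ d) (γ₀ / 2)
        (L.site x.1 γ) (L.site y.1 0)) := by
  have hs : 0 ≤ expSumConst d m := expSumConst_nonneg m
  have hD : 0 ≤ 1 + expSumConst d m * γ₀⁻¹ ^ d := by positivity
  set u : (Fin d → ℤ) → Fin M × Fin Nb → Fin M × Fin Nb → ℝ := fun γ x y =>
    L.shiftAlong e x - L.shiftAlong e y + ∑ s, L.vecAlong e s * γ s with hu
  have hud : ∀ γ x y, |u γ x y| ≤ ‖(L.site x.1 γ : Space d) - L.site y.1 0‖ := by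
    intro γ x y
    have h1 := displacement_eq (L := L) e γ 0 x y
    rw [sub_zero] at h1
    rw [hu]
    simp only
    rw [h1]
    exact (abs_real_inner_le_norm _ _).trans (mul_le_of_le_one_left (norm_nonneg _) he)
  have hzu : ∀ z ∈ Metric.ball (0 : ℂ) R, ∀ γ x y, ‖-z * ((u γ x y : ℝ) : ℂ)‖ ≤
      ‖z‖ * ‖(L.site x.1 γ : Space d) - L.site y.1 0‖ ∧
      ‖z‖ * ‖(L.site x.1 γ : Space d) - L.site y.1 0‖ ≤
        γ₀ / 4 * ‖(L.site x.1 γ : Space d) - L.site y.1 0‖ := by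
    intro z hz γ x y
    rw [mem_ball_zero_iff] at hz
    rw [norm_mul, norm_neg, Complex.norm_real, Real.norm_eq_abs]
    exact ⟨mul_le_mul_of_nonneg_left (hud γ x y) (norm_nonneg _),
      mul_le_mul_of_nonneg_right (hz.le.trans hR) (norm_nonneg _)⟩
  have hnorm : ∀ z ∈ Metric.ball (0 : ℂ) R, ∀ γ x y,
      ‖tilt (L.coef h t) (L.shiftAlong e) (L.vecAlong e) z γ x y‖ ≤
        h₀ * expWeight (1 + expSumConst d m * γ₀⁻¹ ^ d) (γ₀ / 2)
          (L.site x.1 γ) (L.site y.1 0) := by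
    intro z hz γ x y
    obtain ⟨h1, h2⟩ := hzu z hz γ x y
    rw [tilt, norm_mul]
    calc ‖L.coef h t γ x y‖ * ‖Complex.exp (-z * ((u γ x y : ℝ) : ℂ))‖
        ≤ (h₀ * expWeight (1 + expSumConst d m * γ₀⁻¹ ^ d) γ₀ (L.site x.1 γ) (L.site y.1 0)) *
          Real.exp (γ₀ / 4 * ‖(L.site x.1 γ : Space d) - L.site y.1 0‖) := by
          refine mul_le_mul (H.norm_coef_le hm hL hh hγ γ x y) ?_ (norm_nonneg _)
            (mul_nonneg hh.le (expWeight_nonneg hD _ _ _))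
          exact (Complex.norm_exp_le_exp_norm _).trans (Real.exp_le_exp.2 (h1.trans h2))
      _ ≤ _ := by
          rw [mul_assoc]
          exact mul_le_mul_of_nonneg_left (expWeight_mul_exp_le _ hγ _ _) hh.le
  have hsum : ∀ x y : Fin M × Fin Nb, Summable fun γ : Fin d → ℤ =>
      h₀ * expWeight (1 + expSumConst d m * γ₀⁻¹ ^ d) (γ₀ / 2) (L.site x.1 γ) (L.site y.1 0) :=
    fun x y => (summable_expWeight_site hm hL hD (half_pos hγ) x.1 (L.site y.1 0)).mul_left h₀
  refine ⟨hsum, hnorm, fun z hz θ => ?_⟩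
  have hst : ∀ x y, Summable fun γ =>
      ‖tilt (L.coef h t) (L.shiftAlong e) (L.vecAlong e) z γ x y‖ := fun x y =>
    Summable.of_nonneg_of_le (fun _ => norm_nonneg _) (fun γ => hnorm z hz γ x y) (hsum x y)
  have hsc := H.summable_norm_coef hm hL hh hγ
  have hdiff : ∀ γ x y, ‖tilt (L.coef h t) (L.shiftAlong e) (L.vecAlong e) z γ x y -
      L.coef h t γ x y‖ ≤
        ‖z‖ * (h₀ * (4 / γ₀)) * expWeight 0 (γ₀ / 2) (L.site x.1 γ) (L.site y.1 0) := by
    intro γ x y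
    obtain ⟨h1, h2⟩ := hzu z hz γ x y
    set r := ‖(L.site x.1 γ : Space d) - L.site y.1 0‖ with hr
    -- From `|exp w - 1| ≤ |w| * exp |w|`; the factor `‖z‖` makes the perturbation linear in the
    -- tilt.
    have h3 : ‖Complex.exp (-z * ((u γ x y : ℝ) : ℂ)) - 1‖ ≤
        ‖z‖ * (r * Real.exp (γ₀ / 4 * r)) := by
      have := Complex.norm_exp_sub_sum_le_norm_mul_exp (-z * ((u γ x y : ℝ) : ℂ)) 1
      simp only [Finset.sum_range_one, pow_zero, Nat.factorial_zero, Nat.cast_one, div_one,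
        pow_one] at this
      refine this.trans ?_
      rw [← mul_assoc]
      exact mul_le_mul h1 (Real.exp_le_exp.2 (h1.trans h2)) (Real.exp_pos _).le (by positivity)
    have h4 : tilt (L.coef h t) (L.shiftAlong e) (L.vecAlong e) z γ x y - L.coef h t γ x y =
        L.coef h t γ x y * (Complex.exp (-z * ((u γ x y : ℝ) : ℂ)) - 1) := by
      rw [tilt, mul_sub, mul_one]
    rw [h4, norm_mul]
    calc ‖L.coef h t γ x y‖ * ‖Complex.exp (-z * ((u γ x y : ℝ) : ℂ)) - 1‖
        ≤ (h₀ * expWeight (1 + expSumConst d m * γ₀⁻¹ ^ d) γ₀ (L.site x.1 γ) (L.site y.1 0)) *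
          (‖z‖ * (r * Real.exp (γ₀ / 4 * r))) :=
          mul_le_mul (H.norm_coef_le hm hL hh hγ γ x y) h3 (norm_nonneg _)
            (mul_nonneg hh.le (expWeight_nonneg hD _ _ _))
      _ = h₀ * ‖z‖ * (expWeight (1 + expSumConst d m * γ₀⁻¹ ^ d) γ₀ (L.site x.1 γ)
            (L.site y.1 0) * (r * Real.exp (γ₀ / 4 * r))) := by ring
      _ ≤ h₀ * ‖z‖ * (4 / γ₀ * expWeight 0 (γ₀ / 2) (L.site x.1 γ) (L.site y.1 0)) :=
          mul_le_mul_of_nonneg_left (expWeight_mul_norm_mul_exp_le _ hγ _ _)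
            (mul_nonneg hh.le (norm_nonneg _))
      _ = _ := by ring
  have hsd : ∀ x y : Fin M × Fin Nb, Summable fun γ : Fin d → ℤ =>
      ‖z‖ * (h₀ * (4 / γ₀)) * expWeight 0 (γ₀ / 2) (L.site x.1 γ) (L.site y.1 0) :=
    fun x y => (summable_expWeight_site (D := 0) hm hL le_rfl (half_pos hγ) x.1 (L.site y.1 0)).mul_left _
  have hsd' : ∀ x y, Summable fun γ => ‖tilt (L.coef h t) (L.shiftAlong e) (L.vecAlong e) z γ x y -
      L.coef h t γ x y‖ := fun x y => Summable.of_nonneg_of_le (fun _ => norm_nonneg _)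
    (fun γ => hdiff γ x y) (hsd x y)
  rw [symbol_sub hst hsc]
  refine (norm_symbol_le hsd' θ).trans ?_
  rw [mul_left_comm]
  refine sum_sum_le_card_sq_mul fun x y => ?_
  refine (Summable.tsum_le_tsum (fun γ => hdiff γ x y) (hsd' x y) (hsd x y)).trans ?_
  rw [tsum_mul_left]
  refine (mul_le_mul_of_nonneg_left ?_ (by positivity)).trans_eq (mul_assoc _ _ _)
  exact (tsum_expWeight_site_le (D := 0) hm hL le_rfl (half_pos hγ) x.1 (L.site y.1 0)).trans_eq
    (zero_add _)

end

/-- The point of the torus with coordinates `x` modulo `ℤ^d`. -/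
def toTorus {d : ℕ} (x : Fin d → ℝ) : UnitAddTorus (Fin d) := fun s => (x s : UnitAddCircle)

variable (L) in
/-- The reciprocal vector `2π A^{-T} x`. -/
def recipVec (x : Fin d → ℝ) : Space d :=
  WithLp.toLp 2 ((2 * Real.pi) • ((L.A⁻¹)ᵀ *ᵥ x))

/-- `A⁻¹` cancels `A`, so Bloch phases of lattice vectors become characters of the torus. -/
lemma inner_vec_recipVec (γ : Fin d → ℤ) (x : Fin d → ℝ) :
    ⟪L.vec γ, L.recipVec x⟫_ℝ = 2 * Real.pi * ∑ s, γ s * x s := by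
  have h1 : ⟪L.vec γ, L.recipVec x⟫_ℝ =
      ((2 * Real.pi) • ((L.A⁻¹)ᵀ *ᵥ x)) ⬝ᵥ (L.A *ᵥ fun s => (γ s : ℝ)) := by
    rw [vec, latticeVec, recipVec, EuclideanSpace.inner_toLp_toLp]
    simp
  rw [h1, smul_dotProduct, Matrix.dotProduct_mulVec, Matrix.vecMul_mulVec, Matrix.transpose_transpose,
    Matrix.nonsing_inv_mul _ (isUnit_iff_ne_zero.2 L.det_ne_zero), smul_eq_mul]
  simp [dotProduct, mul_comm]

/-- The Bloch Hamiltonian is unitarily equivalent to the symbol of the Hamiltonian. -/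
lemma bloch_recipVec (h t : Fin Nb → Fin Nb → Space d → S → S → ℝ) (x : Fin d → ℝ) :
    L.bloch h t (L.recipVec x) =
      Unitary.conjStarAlgAut ℂ _
        (phase (fun i : Fin M × Fin Nb => ⟪L.shift i.1, L.recipVec x⟫_ℝ) 1)
        (symbol (L.coef h t) (toTorus x)) := by
  ext i j
  rw [conj_phase_apply, bloch, symbol, ← tsum_mul_left, ← tsum_mul_right]
  refine tsum_congr fun γ => ?_
  have h1 : UnitAddTorus.mFourier (-γ) (toTorus x) = Complex.exp (-Complex.I *
      ((⟪L.vec γ, L.recipVec x⟫_ℝ : ℝ) : ℂ)) := by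
    refine (mFourier_apply_coe (-γ) x).trans ?_
    rw [inner_vec_recipVec]
    congr 1
    push_cast
    simp
  have h2 : Complex.exp (-Complex.I *
        ((⟪L.shift i.1 - L.shift j.1 + L.vec γ, L.recipVec x⟫_ℝ : ℝ) : ℂ)) =
      Complex.exp (-(1 * ⟪L.shift i.1, L.recipVec x⟫_ℝ : ℝ) * Complex.I) *
        Complex.exp (-Complex.I * ((⟪L.vec γ, L.recipVec x⟫_ℝ : ℝ) : ℂ)) *
        Complex.exp ((1 * ⟪L.shift j.1, L.recipVec x⟫_ℝ : ℝ) * Complex.I) := by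
    rw [← Complex.exp_add, ← Complex.exp_add, inner_add_left, inner_sub_left]
    congr 1
    push_cast
    ring
  rw [h1, h2, coef]
  ring

end Multilattice

/-! ### Ordered eigenvalues and their continuity at a gap -/

section Bands

open scoped Matrix.Norms.L2Operator

variable {ι : Type*} [Fintype ι] [DecidableEq ι]

lemma range_eigenvalues₀_eq_spectrum {B : Matrix ι ι ℂ} (hB : B.IsHermitian) :
    Set.range hB.eigenvalues₀ = spectrum ℝ B := by
  rw [hB.spectrum_real_eq_range_eigenvalues]
  unfold Matrix.IsHermitian.eigenvalues
  ext r
  simp only [Set.mem_range]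
  constructor
  · rintro ⟨k, rfl⟩
    exact ⟨Fintype.equivOfCardEq (Fintype.card_fin _) k, by simp⟩
  · rintro ⟨i, rfl⟩
    exact ⟨_, rfl⟩

lemma nthEigenvalue_mem_spectrum {B : Matrix ι ι ℂ} (hB : B.IsHermitian) {n : ℕ} (h1 : 1 ≤ n)
    (hn : n ≤ Fintype.card ι) : nthEigenvalue B n ∈ spectrum ℝ B := by
  rw [nthEigenvalue, dif_pos ⟨hB, h1, hn⟩, ← range_eigenvalues₀_eq_spectrum hB]
  exact Set.mem_range_self _

/-- In the decreasing enumeration the two eigenvalues have the adjacent indices `card - n` and `card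
- (n + 1)`, so every other index lies beyond one of them. -/
lemma le_nthEigenvalue_or_nthEigenvalue_succ_le {B : Matrix ι ι ℂ} (hB : B.IsHermitian) {n : ℕ}
    (h1 : 1 ≤ n) (hn : n < Fintype.card ι) {r : ℝ} (hr : r ∈ spectrum ℝ B) :
    r ≤ nthEigenvalue B n ∨ nthEigenvalue B (n + 1) ≤ r := by
  rw [nthEigenvalue, dif_pos ⟨hB, h1, hn.le⟩, nthEigenvalue, dif_pos ⟨hB, by omega, hn⟩]
  rw [← range_eigenvalues₀_eq_spectrum hB] at hr
  obtain ⟨k, rfl⟩ := hr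
  rcases le_or_gt (Fintype.card ι - n) k with h | h
  · exact Or.inl (hB.eigenvalues₀_antitone (Fin.le_def.2 h))
  · exact Or.inr (hB.eigenvalues₀_antitone (Fin.le_def.2 (by simp only; omega)))

/-- The ordered eigenvalues are the sorted roots of the characteristic polynomial, which conjugation
preserves. -/
lemma nthEigenvalue_conj_unitary (U : unitary (Matrix ι ι ℂ)) {B : Matrix ι ι ℂ}
    (hB : B.IsHermitian) (n : ℕ) :
    nthEigenvalue (Unitary.conjStarAlgAut ℂ _ U B) n = nthEigenvalue B n := by
  have hB' : (Unitary.conjStarAlgAut ℂ _ U B).IsHermitian :=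
    IsSelfAdjoint.map (f := Unitary.conjStarAlgAut ℂ (Matrix ι ι ℂ) U) hB
  have hchar : (Unitary.conjStarAlgAut ℂ _ U B).charpoly = B.charpoly := by
    rw [Unitary.conjStarAlgAut_apply, Matrix.charpoly_mul_comm, ← mul_assoc,
      Unitary.coe_star_mul_self, one_mul]
  have h0 : hB'.eigenvalues₀ = hB.eigenvalues₀ := by
    refine List.ofFn_injective ?_
    rw [← hB'.sort_roots_charpoly_eq_eigenvalues₀, ← hB.sort_roots_charpoly_eq_eigenvalues₀, hchar]
  unfold nthEigenvalue
  by_cases h : 1 ≤ n ∧ n ≤ Fintype.card ι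
  · rw [dif_pos ⟨hB', h⟩, dif_pos ⟨hB, h⟩, h0]
  · rw [dif_neg fun h' => h h'.2, dif_neg fun h' => h h'.2]

/-- The eigenvalues adjacent to a gap depend continuously on the matrix. -/
lemma continuous_nthEigenvalue_of_gap {X : Type*} [TopologicalSpace X] {G : X → Matrix ι ι ℂ}
    (hG : Continuous G) (hherm : ∀ θ, (G θ).IsHermitian) {n : ℕ} (h1 : 1 ≤ n)
    (hn : n < Fintype.card ι) {μ : ℝ} (hlt : ∀ θ, nthEigenvalue (G θ) n < μ)
    (hgt : ∀ θ, μ < nthEigenvalue (G θ) (n + 1)) :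
    Continuous (fun θ => nthEigenvalue (G θ) n) ∧
      Continuous (fun θ => nthEigenvalue (G θ) (n + 1)) := by
  have hmem := fun θ => nthEigenvalue_mem_spectrum (hherm θ) h1 hn.le
  have hmem' := fun θ => nthEigenvalue_mem_spectrum (hherm θ) (Nat.le_add_left 1 n) hn
  have hsplit := fun θ r (hr : r ∈ spectrum ℝ (G θ)) =>
    le_nthEigenvalue_or_nthEigenvalue_succ_le (hherm θ) h1 hn hr
  have key : ∀ θ₀, ∀ ε > 0, ∀ᶠ θ in nhds θ₀,
      |nthEigenvalue (G θ) n - nthEigenvalue (G θ₀) n| < ε ∧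
        |nthEigenvalue (G θ) (n + 1) - nthEigenvalue (G θ₀) (n + 1)| < ε := by
    intro θ₀ ε hε
    -- A perturbation smaller than `δ` cannot pair an eigenvalue below `μ` with one above it.
    -- Comparing the spectra in both directions then bounds each edge of the gap from both sides.
    set δ := min (μ - nthEigenvalue (G θ₀) n) (nthEigenvalue (G θ₀) (n + 1) - μ)
    have hδ : 0 < δ := lt_min (sub_pos.2 (hlt θ₀)) (sub_pos.2 (hgt θ₀))
    have hδ1 : δ ≤ μ - nthEigenvalue (G θ₀) n := min_le_left _ _
    have hδ2 : δ ≤ nthEigenvalue (G θ₀) (n + 1) - μ := min_le_right _ _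
    filter_upwards [(Metric.tendsto_nhds.1 (hG.tendsto θ₀)) _ (lt_min hε hδ)] with θ hθ
    rw [dist_eq_norm] at hθ
    obtain ⟨hrε, hrδ⟩ := lt_min_iff.1 hθ
    have near : ∀ r ∈ spectrum ℝ (G θ), ∃ s ∈ spectrum ℝ (G θ₀), |r - s| ≤ ‖G θ - G θ₀‖ :=
      fun r hr => exists_mem_spectrum_abs_sub_le (E := Matrix ι ι ℂ) (hherm θ₀) hr
    have near' : ∀ r ∈ spectrum ℝ (G θ₀), ∃ s ∈ spectrum ℝ (G θ), |r - s| ≤ ‖G θ - G θ₀‖ :=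
      fun r hr => by
        rw [norm_sub_rev]
        exact exists_mem_spectrum_abs_sub_le (E := Matrix ι ι ℂ) (hherm θ) hr
    obtain ⟨s₁, hs₁, hd₁⟩ := near _ (hmem θ)
    obtain ⟨s₂, hs₂, hd₂⟩ := near' _ (hmem θ₀)
    obtain ⟨s₃, hs₃, hd₃⟩ := near _ (hmem' θ)
    obtain ⟨s₄, hs₄, hd₄⟩ := near' _ (hmem' θ₀)
    have a₁ := abs_le.1 hd₁
    have a₂ := abs_le.1 hd₂
    have a₃ := abs_le.1 hd₃
    have a₄ := abs_le.1 hd₄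
    have b₁ := hlt θ
    have b₂ := hgt θ
    refine ⟨abs_lt.2 ⟨?_, ?_⟩, abs_lt.2 ⟨?_, ?_⟩⟩
    · rcases hsplit θ _ hs₂ with h | h <;> linarith
    · rcases hsplit θ₀ _ hs₁ with h | h <;> linarith
    · rcases hsplit θ₀ _ hs₃ with h | h <;> linarith
    · rcases hsplit θ _ hs₄ with h | h <;> linarith
  constructor <;> refine continuous_iff_continuousAt.2 fun θ₀ => Metric.tendsto_nhds.2 fun ε hε => ?_
  · filter_upwards [key θ₀ ε hε] with θ hθ using hθ.1
  · filter_upwards [key θ₀ ε hε] with θ hθ using hθ.2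

end Bands

/-! ### Bands as functions on the torus -/

namespace Multilattice

open scoped Matrix.Norms.L2Operator

variable {d M : ℕ} {S : Type*} {L : Multilattice d M S} {m : ℝ} {Nb : ℕ}
  {h t : Fin Nb → Fin Nb → Space d → S → S → ℝ} {h₀ γ₀ : ℝ}

lemma exists_toTorus_eq (θ : UnitAddTorus (Fin d)) :
    ∃ x : Fin d → ℝ, (∀ s, -(1 / 2) ≤ x s ∧ x s < 1 / 2) ∧ toTorus x = θ := by
  have : Fact ((0 : ℝ) < 1) := ⟨one_pos⟩
  refine ⟨fun s => (AddCircle.equivIco (1 : ℝ) (-(1 / 2)) (θ s) : ℝ), fun s => ?_, ?_⟩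
  · obtain ⟨h1, h2⟩ := (AddCircle.equivIco (1 : ℝ) (-(1 / 2)) (θ s)).2
    exact ⟨h1, by linarith⟩
  · funext s
    exact AddCircle.coe_equivIco

lemma TB.symbol_coef_isHermitian (H : L.TB h t h₀ γ₀) (θ : UnitAddTorus (Fin d)) :
    (symbol (L.coef h t) θ).IsHermitian :=
  symbol_isHermitian H.star_coef θ

lemma TB.band_recipVec (H : L.TB h t h₀ γ₀) (n : ℕ) (x : Fin d → ℝ) :
    L.band h t n (L.recipVec x) = nthEigenvalue (symbol (L.coef h t) (toTorus x)) n := by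
  rw [band, bloch_recipVec, nthEigenvalue_conj_unitary _ (H.symbol_coef_isHermitian _)]

/-- The bands on the cell `Γ*` are the eigenvalues of the symbol on the torus. -/
lemma TB.image_recipCell (H : L.TB h t h₀ γ₀) {V : Type*} (f : ℝ → ℝ → V) (n n' : ℕ) :
    (fun ξ => f (L.band h t n ξ) (L.band h t n' ξ)) '' L.recipCell =
      Set.range fun θ => f (nthEigenvalue (symbol (L.coef h t) θ) n)
        (nthEigenvalue (symbol (L.coef h t) θ) n') := by
  ext g
  constructor
  · rintro ⟨ξ, ⟨x, -, rfl⟩, rfl⟩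
    refine ⟨toTorus x, ?_⟩
    simp only [← H.band_recipVec]
    rfl
  · rintro ⟨θ, rfl⟩
    obtain ⟨x, hx, rfl⟩ := exists_toTorus_eq θ
    refine ⟨L.recipVec x, ⟨x, hx, rfl⟩, ?_⟩
    simp only [H.band_recipVec]

end Multilattice

/-! ### The direct gap and the entries of the density matrix -/

namespace Multilattice

open scoped Matrix.Norms.L2Operator

variable {d M : ℕ} {S : Type*} {L : Multilattice d M S} {m : ℝ} {Nb : ℕ}
  {h t : Fin Nb → Fin Nb → Space d → S → S → ℝ} {h₀ γ₀ : ℝ}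

/-- The direct gap is attained, and the symbol of the Hamiltonian has a direct gap of this
width. -/
lemma TB.isLeast_gapPlus_and_directGap (H : L.TB h t h₀ γ₀)
    (hc : ∀ x y, Summable fun γ => ‖L.coef h t γ x y‖) {εF : ℝ} {N₀ : ℕ}
    (F : L.FermiLevelInGap h t εF N₀) {B : ℝ} (hB : 0 < B)
    (hcB : ∀ θ, ‖symbol (L.coef h t) θ‖ ≤ B) :
    IsLeast (L.gapValues h t N₀) (L.gapPlus h t N₀) ∧
      ∃ μ δ, DirectGap (L.coef h t) μ εF B (L.gapPlus h t N₀) δ := by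
  have hcard : N₀ < Fintype.card (Fin M × Fin Nb) := by simpa using F.lt_card
  have hne : Nonempty (Fin M × Fin Nb) :=
    Fintype.card_pos_iff.1 ((Nat.zero_le _).trans_lt hcard)
  set f := fun θ => nthEigenvalue (symbol (L.coef h t) θ) N₀ with hf
  set f' := fun θ => nthEigenvalue (symbol (L.coef h t) θ) (N₀ + 1) with hf'
  have hlt : ∀ θ, f θ < εF := fun θ => by
    obtain ⟨x, hx, rfl⟩ := exists_toTorus_eq θ
    rw [hf]
    simp only
    rw [← H.band_recipVec]
    exact F.valence_lt _ ⟨x, hx, rfl⟩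
  have hgt : ∀ θ, εF < f' θ := fun θ => by
    obtain ⟨x, hx, rfl⟩ := exists_toTorus_eq θ
    rw [hf']
    simp only
    rw [← H.band_recipVec]
    exact F.lt_conduction _ ⟨x, hx, rfl⟩
  have hherm := H.symbol_coef_isHermitian
  obtain ⟨hfc, hfc'⟩ : Continuous f ∧ Continuous f' :=
    continuous_nthEigenvalue_of_gap (continuous_symbol hc) hherm F.one_le hcard hlt hgt
  -- Two separate minima over the compact torus: `θ₁` realises the direct gap, `θ₂` the least
  -- distance `δ` from the Fermi level to the two adjacent bands.
  obtain ⟨θ₁, -, hθ₁⟩ := isCompact_univ.exists_isMinOn Set.univ_nonempty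
    (hfc'.sub hfc).continuousOn
  obtain ⟨θ₂, -, hθ₂⟩ := isCompact_univ.exists_isMinOn Set.univ_nonempty
    ((continuous_const.sub hfc).min (hfc'.sub continuous_const) :
      Continuous fun θ => min (εF - f θ) (f' θ - εF)).continuousOn
  have hmin : ∀ θ, f' θ₁ - f θ₁ ≤ f' θ - f θ := fun θ => hθ₁ (Set.mem_univ θ)
  have hmin' : ∀ θ, min (εF - f θ₂) (f' θ₂ - εF) ≤ min (εF - f θ) (f' θ - εF) := fun θ =>
    hθ₂ (Set.mem_univ θ)
  have hleast : IsLeast (L.gapValues h t N₀) (f' θ₁ - f θ₁) := by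
    rw [gapValues, H.image_recipCell (fun r r' => r - r') (N₀ + 1) N₀]
    refine ⟨⟨θ₁, rfl⟩, ?_⟩
    rintro _ ⟨θ, rfl⟩
    exact hmin θ
  have hg : L.gapPlus h t N₀ = f' θ₁ - f θ₁ := hleast.csInf_eq
  have habs : ∀ θ, ∀ r ∈ spectrum ℝ (symbol (L.coef h t) θ), |r| ≤ B := fun θ r hr => by
    have := spectrum.norm_le_norm_of_mem hr
    rw [Real.norm_eq_abs] at this
    exact this.trans (hcB θ)
  have hfB := fun θ => abs_le.1 (habs θ _ (nthEigenvalue_mem_spectrum (hherm θ) F.one_le hcard.le))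
  have hfB' := fun θ => abs_le.1
    (habs θ _ (nthEigenvalue_mem_spectrum (hherm θ) (Nat.le_add_left 1 N₀) hcard))
  refine ⟨by rwa [hg], fun θ => (f θ + f' θ) / 2, min (εF - f θ₂) (f' θ₂ - εF), ?_⟩
  rw [hg]
  refine ⟨hherm, by fun_prop, by linarith [hlt θ₁, hgt θ₁], hB,
    lt_min (sub_pos.2 (hlt θ₂)) (sub_pos.2 (hgt θ₂)), ?_, hcB, fun θ => ?_, fun θ r hr => ?_⟩
  · linarith [(hfB θ₁).1, (hfB' θ₁).2]
  · exact abs_le.2 ⟨by linarith [(hfB θ).1, (hfB' θ).1], by linarith [(hfB θ).2, (hfB' θ).2]⟩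
  · have h1 := hmin θ
    have h2 := (hmin' θ).trans (min_le_left _ _)
    have h3 := (hmin' θ).trans (min_le_right _ _)
    rcases le_nthEigenvalue_or_nthEigenvalue_succ_le (hherm θ) F.one_le hcard hr with h | h
    · have h : r ≤ f θ := h
      exact Or.inl ⟨by linarith, by linarith⟩
    · have h : f' θ ≤ r := h
      exact Or.inr ⟨by linarith, by linarith⟩

/-- The entries of the density matrix as Fourier coefficients. -/
lemma entry_densityMatrix_eq_integral (H : L.TB h t h₀ γ₀)
    (hT : L.IsHamiltonian h t (L.hamiltonian h t))
    (hc : ∀ x y, Summable fun γ => ‖L.coef h t γ x y‖) {εF δ : ℝ} (hδ : 0 < δ)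
    (hεF : εF ∉ spectrum ℝ (L.hamiltonian h t))
    (hgap : ∀ θ, ∀ r ∈ spectrum ℝ (symbol (L.coef h t) θ), δ ≤ |r - εF|)
    (x y : Fin M × Fin Nb) (α β : Fin d → ℤ) :
    L.entry (L.densityMatrix h t εF) (L.site x.1 α) (L.site y.1 β) x.2 y.2 =
      ∫ θ, (cfc ((Set.Iio εF).indicator (fun _ => (1 : ℝ))) (symbol (L.coef h t) θ)) x y *
        UnitAddTorus.mFourier (α - β) θ := by
  classical
  have hne : Nonempty (Fin M × Fin Nb) := ⟨x⟩
  have hneI : Nonempty (L.sites × Fin Nb) := ⟨(L.site x.1 α, x.2)⟩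
  refine Eq.trans ?_ (entry_spectralProjection_eq_integral hc H.symbol_coef_isHermitian
    (L.orbitalEquiv Nb) (IsHamiltonian.isSelfAdjoint H hT) (fun x α y β => ?_) hδ hgap hεF x y α β)
  · rfl
  · rw [coef_sub]
    exact hT (L.site x.1 α) (L.site y.1 β) x.2 y.2

end Multilattice

end TightBinding

end

/-! ### The decay estimate with explicit constants -/

open TightBinding in
theorem mainTheorem1 (d M Nb : ℕ) (m : ℝ) (hm : 0 < m) :
    ∃ c₁ C₀ : ℝ, 0 < c₁ ∧ 0 < C₀ ∧
      ∀ (S : Type*) (L : Multilattice d M S) (h t : Fin Nb → Fin Nb → Space d → S → S → ℝ)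
        (h₀ γ₀ : ℝ), 0 < h₀ → 0 < γ₀ → L.Separated m → L.TB h t h₀ γ₀ →
        L.IsHamiltonian h t (L.hamiltonian h t) ∧ IsSelfAdjoint (L.hamiltonian h t) ∧
        ∀ (εF : ℝ) (N₀ : ℕ), L.FermiLevelInGap h t εF N₀ →
          IsLeast (L.gapValues h t N₀) (L.gapPlus h t N₀) ∧
          ∀ (ℓ k : L.sites) (a b : Fin Nb),
            ‖L.entry (L.densityMatrix h t εF) ℓ k a b‖ ≤
              C₀ * (h₀ * (1 + γ₀⁻¹ ^ d)) / L.gapPlus h t N₀ *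
                Real.exp (-(c₁ * (γ₀ / h₀) * min h₀ (γ₀ ^ d * L.gapPlus h t N₀)) *
                  ‖(ℓ : Space d) - (k : Space d)‖) := by
  set s := expSumConst d m with hs_def
  have hs : 0 ≤ s := expSumConst_nonneg m
  set N : ℝ := ((M * Nb : ℕ) : ℝ) ^ 2 with hN_def
  have hN : 0 ≤ N := sq_nonneg _
  -- Chosen so that the radius `R = 2 * η` satisfies both `R ≤ γ₀ / 4` and `R * K ≤ g / 4`; the
  -- second requires `c₁ * (N * s * 2 ^ d) ≤ 1 / 32`. The `+ 1` covers a vanishing product and gives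
  -- `c₁ ≤ 1 / 32`.
  set c₁ : ℝ := 1 / (32 * (N * s * 2 ^ d + 1)) with hc₁_def
  have hc₁ : 0 < c₁ := by positivity
  have hc₁_le : c₁ ≤ 1 / 32 := by
    rw [hc₁_def]
    exact one_div_le_one_div_of_le (by norm_num) (by linarith [show 0 ≤ N * s * 2 ^ d by positivity])
  have hc₁_mul : c₁ * (N * s * 2 ^ d) ≤ 1 / 32 := by
    rw [hc₁_def, div_mul_eq_mul_div, one_mul, div_le_div_iff₀ (by positivity) (by norm_num)]
    linarith
  refine ⟨c₁, 8 * ((N + 1) * (1 + 2 * s)), hc₁, by positivity, ?_⟩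
  intro S L h t h₀ γ₀ hh hγ hL H
  have hT := H.isHamiltonian hm hL hh hγ
  refine ⟨hT, Multilattice.IsHamiltonian.isSelfAdjoint H hT, fun εF N₀ F => ?_⟩
  have hcoef := H.summable_norm_coef hm hL hh hγ
  -- `N + 1` in place of `N` keeps `B` positive in all cases. The prefactor `8 * B / g` then has
  -- exactly the required form.
  set B : ℝ := (N + 1) * (1 + 2 * s) * (h₀ * (1 + γ₀⁻¹ ^ d)) with hB_def
  have hγd : 0 < γ₀⁻¹ ^ d := by positivity
  have hB : 0 < B := by positivity
  have hNB : N * (h₀ * (1 + 2 * s * γ₀⁻¹ ^ d)) ≤ B := by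
    calc N * (h₀ * (1 + 2 * s * γ₀⁻¹ ^ d))
        ≤ (N + 1) * (h₀ * ((1 + 2 * s) * (1 + γ₀⁻¹ ^ d))) := by
          gcongr
          · linarith
          · nlinarith
      _ = B := by ring
  have hcB := fun θ => (H.norm_symbol_coef_le hm hL hh hγ θ).trans hNB
  obtain ⟨hleast, μ, δ, hD⟩ := H.isLeast_gapPlus_and_directGap hcoef F hB hcB
  refine ⟨hleast, fun ℓ k a b => ?_⟩
  obtain ⟨⟨i, α⟩, rfl⟩ := L.site_bijective.surjective ℓ
  obtain ⟨⟨j, β⟩, rfl⟩ := L.site_bijective.surjective k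
  set g := L.gapPlus h t N₀
  have hg : 0 < g := hD.gap_pos
  set v : Space d := (L.site i α : Space d) - L.site j β with hv
  -- For `ℓ = k` this is `0`, since `0⁻¹ = 0`; only `‖e‖ ≤ 1` and `⟪e, v⟫ = ‖v‖` are used, and both
  -- still hold.
  set e : Space d := ‖v‖⁻¹ • v with he_def
  have he : ‖e‖ ≤ 1 := by
    rw [he_def, norm_smul, norm_inv, norm_norm]
    exact inv_mul_le_one
  have hev : inner ℝ e v = ‖v‖ := by
    rw [he_def, real_inner_smul_left, real_inner_self_eq_norm_sq, sq, ← mul_assoc]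
    exact inv_mul_mul_self _
  set η : ℝ := c₁ * (γ₀ / h₀) * min h₀ (γ₀ ^ d * g) with hη_def
  have hη : 0 < η := mul_pos (by positivity) (lt_min hh (by positivity))
  have hc : 0 ≤ c₁ * (γ₀ / h₀) := by positivity
  have hη1 : η ≤ c₁ * γ₀ := by
    calc η ≤ c₁ * (γ₀ / h₀) * h₀ := mul_le_mul_of_nonneg_left (min_le_left _ _) hc
      _ = c₁ * γ₀ := by field_simp
  have hη2 : η ≤ c₁ * (γ₀ / h₀) * (γ₀ ^ d * g) :=
    mul_le_mul_of_nonneg_left (min_le_right _ _) hc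
  -- The factor `2` leaves room for the strict inequality `η < R`.
  have hR : 2 * η ≤ γ₀ / 4 := by nlinarith
  have htilt := H.tiltBound hm hL hh hγ he hR
  rw [← hN_def, ← hs_def] at htilt
  have hRK : 2 * η * (N * (h₀ * (4 / γ₀) * (s * (γ₀ / 2)⁻¹ ^ d))) ≤ g / 4 := by
    calc 2 * η * (N * (h₀ * (4 / γ₀) * (s * (γ₀ / 2)⁻¹ ^ d)))
        ≤ 2 * (c₁ * (γ₀ / h₀) * (γ₀ ^ d * g)) *
          (N * (h₀ * (4 / γ₀) * (s * (γ₀ / 2)⁻¹ ^ d))) := by gcongr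
      _ = 8 * g * (c₁ * (N * s * 2 ^ d)) := by
          rw [inv_div, div_pow]
          field_simp
          ring
      _ ≤ 8 * g * (1 / 32) := by gcongr
      _ = g / 4 := by ring
  have hdist : ∀ θ, ∀ r ∈ spectrum ℝ (symbol (L.coef h t) θ), δ ≤ |r - εF| := fun θ r hr => by
    rcases hD.split θ r hr with h1 | h1
    · exact le_abs.2 (Or.inr (by linarith))
    · exact le_abs.2 (Or.inl (by linarith))
  have key := norm_integral_cfc_symbol_le hD htilt hRK (by positivity) (α - β) (i, a) (j, b)
    (by linarith) hη.le (by linarith)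
  have hentry := Multilattice.entry_densityMatrix_eq_integral H hT hcoef hD.delta_pos
    F.notMem_spectrum hdist (i, a) (j, b) α β
  have hdisp := Multilattice.displacement_eq (L := L) e α β (i, a) (j, b)
  rw [← hentry, hdisp, hev] at key
  refine key.trans (le_of_eq ?_)
  congr 2
  rw [hB_def]
  ring
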